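/- Let $m\ge 1$ and let $C=C^{\perp}\le\mathbb F_2^{24m}$ be an extremal self-dual binary linear code of length $24m$, i.e. a self-dual code with minimum distance $d(C)=4m+4$. Let $\sigma\in\mathrm{Aut}(C)=\{\tau\in S_{24m}\mid \tau(C)=C\}$ be an automorphism of order $2$ without fixed points on the $24m$ coordinates. Let $C(\sigma)=\{c\in C\mid\sigma(c)=c\}$ be the fixed code, and let $\pi(C(\sigma))\le\mathbb F_2^{12m}$ be the code obtained from it by keeping one coordinate from each of the $12m$ two-element orbits of $\sigma$; so, if $\sigma=(1,2)(3,4)\cdots(24m-1,24m)$, then $\pi(C(\sigma))=\{(c_1,\dots,c_{12m})\mid(c_1,c_1,c_2,c_2,\dots,c_{12m},c_{12m})\in C\}$. (i) If $m$ is odd, or if $m=2\mu$ with $\binom{5\mu-1}{\mu-1}$ odd, then $C$ is a free $\mathbb F_2\langle\sigma\rangle$-module. (ii) For every $m\ge 1$, $C$ is a free $\mathbb F_2\langle\sigma\rangle$-module if and only if $\pi(C(\sigma))$ is self-dual. (So, under the condition in (i), $\pi(C(\sigma))$ is self-dual.) -/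

import Mathlib

/-- A binary linear code with coordinates indexed by `ι`; the index type `Fin n` gives the
codes of length `n`. -/
abbrev BinaryCode (ι : Type) : Type := Submodule (ZMod 2) (ι → ZMod 2)

namespace BinaryCode

/-- The dual code with respect to the standard bilinear form `∑ i, c i * v i`. -/
def dual {ι : Type} [Fintype ι] (C : BinaryCode ι) : BinaryCode ι where
  carrier := {v | ∀ c ∈ C, c ⬝ᵥ v = 0}
  zero_mem' := fun c _ => dotProduct_zero c
  add_mem' := fun {u v} hu hv c hc => by rw [dotProduct_add, hu c hc, hv c hc, add_zero]
  smul_mem' := fun a v hv c hc => by rw [dotProduct_smul, hv c hc, smul_zero]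

/-- A code is self-dual if it equals its dual code. -/
def IsSelfDual {ι : Type} [Fintype ι] (C : BinaryCode ι) : Prop := C.dual = C

/-- The minimum distance: the least Hamming weight of a nonzero codeword
(`0` for the zero code). -/
noncomputable def minDist {ι : Type} [Fintype ι] (C : BinaryCode ι) : ℕ :=
  sInf {w : ℕ | ∃ c ∈ C, c ≠ 0 ∧ hammingNorm c = w}

/-- A self-dual binary code of length `n` is extremal if its minimum distance attains the
general upper bound, `4 ⌊n / 24⌋ + 6` if `n ≡ 22 (mod 24)` and `4 ⌊n / 24⌋ + 4` otherwise. -/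
def IsExtremal {n : ℕ} (C : BinaryCode (Fin n)) : Prop :=
  C.IsSelfDual ∧ C.minDist = if n % 24 = 22 then 4 * (n / 24) + 6 else 4 * (n / 24) + 4

/-- The action of permutations on words: the `i`-th coordinate of a word is moved to
position `σ i`. -/
def permRep (ι : Type) : Representation (ZMod 2) (Equiv.Perm ι) (ι → ZMod 2) where
  toFun σ := LinearMap.funLeft (ZMod 2) (ZMod 2) (σ⁻¹ : Equiv.Perm ι)
  map_one' := rfl
  map_mul' _ _ := rfl

/-- The automorphism group of a code: the permutations `σ` of the coordinates such that
`σ(C) = C`. -/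
def autGroup {ι : Type} (C : BinaryCode ι) : Subgroup (Equiv.Perm ι) where
  carrier := {σ | C.map (permRep ι σ) = C}
  one_mem' := by
    change C.map (permRep ι 1) = C
    rw [map_one]
    exact Submodule.map_id C
  mul_mem' := fun {σ τ} hσ hτ => by
    change C.map (permRep ι (σ * τ)) = C
    rw [map_mul, Module.End.mul_eq_comp, Submodule.map_comp, hτ, hσ]
  inv_mem' := fun {σ} hσ => by
    change C.map (permRep ι σ⁻¹) = C
    conv_lhs => rw [← (show C.map (permRep ι σ) = C from hσ)]
    rw [← Submodule.map_comp, ← Module.End.mul_eq_comp, ← map_mul, inv_mul_cancel, map_one]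
    exact Submodule.map_id C

theorem permRep_mem {ι : Type} (C : BinaryCode ι) (σ : C.autGroup) (c : ι → ZMod 2)
    (hc : c ∈ C) : permRep ι (σ : Equiv.Perm ι) c ∈ C := by
  have h : C.map (permRep ι (σ : Equiv.Perm ι)) = C := σ.2
  exact h.le (Submodule.mem_map_of_mem hc)

/-- The code `C` as a representation of its automorphism group over `𝔽₂`. -/
def autRep {ι : Type} (C : BinaryCode ι) : Representation (ZMod 2) C.autGroup C where
  toFun σ := (permRep ι (σ : Equiv.Perm ι)).restrict (C.permRep_mem σ)
  map_one' := rfl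
  map_mul' _ _ := rfl

/-- The code `C` as a representation of the cyclic group `⟨σ⟩` over `𝔽₂`. -/
def cyclicRep {ι : Type} (C : BinaryCode ι) (σ : C.autGroup) :
    Representation (ZMod 2) (Subgroup.zpowers σ) C :=
  C.autRep.comp (Subgroup.zpowers σ).subtype

/-- `C` is a free module over the group algebra `𝔽₂⟨σ⟩`. -/
def IsFreeModule {ι : Type} (C : BinaryCode ι) (σ : C.autGroup) : Prop :=
  Module.Free (MonoidAlgebra (ZMod 2) (Subgroup.zpowers σ)) (C.cyclicRep σ).asModule

/-- The fixed code `C(σ)`: the codewords `c` with `σ(c) = c`. -/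
def fixedCode {ι : Type} (C : BinaryCode ι) (σ : Equiv.Perm ι) : BinaryCode ι :=
  C ⊓ LinearMap.eqLocus (permRep ι σ) LinearMap.id

/-- The set of orbits of `⟨σ⟩` on the coordinates. -/
abbrev Orbits {ι : Type} (σ : Equiv.Perm ι) : Type := Quotient (Equiv.Perm.SameCycle.setoid σ)

noncomputable instance instFintypeOrbits {ι : Type} [Fintype ι] (σ : Equiv.Perm ι) :
    Fintype (Orbits σ) :=
  Fintype.ofFinite _

/-- The projected fixed code `π(C(σ))`: a word of `C(σ)` is constant on the orbits of `σ`, and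
`π` keeps one coordinate for each orbit. So the projected code, whose coordinates are indexed by
the orbits, consists of the words `v` for which repeating `v` along the orbits gives a word
of `C(σ)`. -/
def projFixedCode {ι : Type} (C : BinaryCode ι) (σ : Equiv.Perm ι) : BinaryCode (Orbits σ) :=
  (C.fixedCode σ).comap
    (LinearMap.funLeft (ZMod 2) (ZMod 2)
      (fun i : ι => (Quotient.mk (Equiv.Perm.SameCycle.setoid σ) i : Orbits σ)))

end BinaryCode

/-! Put `e = 1 + σ`. Since `σ` has order 2, the group algebra is the algebra of dual numbers in `e`,
and `C` is free exactly when the kernel of `e` on `C` equals its image (`isFreeModule_iff`). The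
kernel is the fixed code. Projected to the orbits, the image is the code `E` of orbit sums. A dot
product with a word constant on orbits is a dot product of orbit sums, so for self-dual `C` the dual
of `E` is `π(C(σ))`, which contains `E`. Kernel equals image if and only if `E` is self-dual, which
is (ii).

For (i), an extremal code of length `24m` is doubly even (`four_dvd_hammingNorm`), so `π(C(σ))` is
even, with nonzero weights at least `2m + 2`. If it were not self-dual, some `V ⊇ E` would be
self-orthogonal of index 4 in its dual, with `V.dual` inside `π(C(σ))`. By MacWilliams, `2 W_V -
W_{V^⊥}` is a relative invariant of sign -1, so by Gleason's theorem it is `1 - 6X + X²` times a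
combination of powers of `1 + X` and `X(1 - X)²`. Its shadow is a multiple of the weight enumerator
of an actual set of words. Lagrange inversion computes the `m`-th coefficient `a` of the combination
twice. The minimum weight gives a sum of binomials; the shadow gives `(-1)^m a ∈ 4ℕ`. For odd `m`
the signs disagree, and for `m = 2μ` one finds `a = 6 * choose (5μ - 1) (μ - 1)`, so that binomial
is even (`semi_self_dual_restriction`).

Double evenness is proved by the same two computations for the self-dual code. Two consecutive
coefficients force its nonnegative shadow enumerator to have a nonzero constant term
(`shadow_coeff_zero_ne_zero`), and the zero word lies in the shadow only if 4 divides all weights.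
-/

namespace GleasonExpansion

/-! ### Formal residues and Lagrange inversion. -/

section PowerSeries

open PowerSeries

/-- The power series `1 / (1 - X)`. -/
noncomputable def geom : ℝ⟦X⟧ := PowerSeries.mk 1

/-- The power series `1 / (1 + X)`. -/
noncomputable def altGeom : ℝ⟦X⟧ := PowerSeries.mk fun n => (-1) ^ n

theorem geom_mul : geom * (1 - X) = 1 := PowerSeries.mk_one_mul_one_sub_eq_one ℝ

theorem altGeom_mul : altGeom * (1 + X) = 1 := by
  ext n
  cases n with
  | zero => simp [altGeom, mul_add]
  | succ n => simp [altGeom, mul_add, coeff_succ_mul_X, pow_succ, coeff_one]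

theorem geom_pow_mul (k : ℕ) : geom ^ k * (1 - X) ^ k = 1 := by
  rw [← mul_pow, geom_mul, one_pow]

theorem altGeom_pow_mul (k : ℕ) : altGeom ^ k * (1 + X) ^ k = 1 := by
  rw [← mul_pow, altGeom_mul, one_pow]

theorem coeff_geom_pow (d n : ℕ) : coeff n (geom ^ (d + 1)) = ((d + n).choose d : ℝ) := by
  rw [geom, mk_one_pow_eq_mk_choose_add, coeff_mk]

theorem geom_mul_altGeom_pow (d : ℕ) :
    (geom * altGeom) ^ d = PowerSeries.expand 2 two_ne_zero (geom ^ d) := by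
  rw [map_pow]
  congr 1
  have h : PowerSeries.expand 2 two_ne_zero geom * (1 - X ^ 2) = 1 := by
    have := congrArg (PowerSeries.expand 2 two_ne_zero) geom_mul
    simpa [map_mul, map_sub, expand_X] using this
  calc geom * altGeom
      = geom * altGeom * (PowerSeries.expand 2 two_ne_zero geom * (1 - X ^ 2)) := by
        rw [h, mul_one]
    _ = (geom * (1 - X)) * (altGeom * (1 + X)) * PowerSeries.expand 2 two_ne_zero geom := by ring
    _ = _ := by rw [geom_mul, altGeom_mul]; ring

theorem coeff_geom_mul_altGeom_pow_even (d n : ℕ) :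
    coeff (2 * n) ((geom * altGeom) ^ d) = coeff n (geom ^ d) := by
  rw [geom_mul_altGeom_pow, coeff_expand_mul]

theorem coeff_geom_mul_altGeom_pow_odd (d n : ℕ) :
    coeff (2 * n + 1) ((geom * altGeom) ^ d) = 0 := by
  rw [geom_mul_altGeom_pow, coeff_expand_of_not_dvd]
  omega

/-- The residue of the logarithmic derivative of a nonzero power vanishes. -/
theorem coeff_sub_X_mul_derivative (k : ℕ) (f : ℝ⟦X⟧) :
    coeff k ((k : ℝ⟦X⟧) * f - X * PowerSeries.derivative ℝ f) = 0 := by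
  cases k with
  | zero => simp
  | succ k =>
    have : ((k + 1 : ℕ) : ℝ⟦X⟧) = PowerSeries.C ((k : ℝ) + 1) := by simp
    rw [map_sub, this, coeff_C_mul, coeff_succ_X_mul, coeff_derivative]
    ring

/-- With `φ = X(1 - X)²/(1 + X)⁴`, one has `X φ'/φ = (1 - 6X + X²)/(1 - X²)`. The coefficient is
therefore the residue of `φ'/φ^(k+1)`, which vanishes because this is a derivative when `k > 0`. -/
theorem coeff_kernel (k : ℕ) (hk : 0 < k) :
    coeff k ((1 - 6 * X + X ^ 2) * ((1 + X) ^ (4 * k - 1) * geom ^ (2 * k + 1))) = (0 : ℝ) := by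
  have h := coeff_sub_X_mul_derivative k ((1 + X) ^ (4 * k) * geom ^ (2 * k))
  have hg : PowerSeries.derivative ℝ geom = geom ^ 2 := by
    have h1 := congrArg (PowerSeries.derivative ℝ) geom_mul
    simp only [Derivation.leibniz, map_sub, Derivation.map_one_eq_zero, smul_eq_mul, derivative_X] at h1
    have h2 : (1 - X) * PowerSeries.derivative ℝ geom = geom := by
      linear_combination h1
    calc _ = (geom * (1 - X)) * PowerSeries.derivative ℝ geom := by rw [geom_mul, one_mul]
      _ = geom * ((1 - X) * PowerSeries.derivative ℝ geom) := by ring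
      _ = _ := by rw [h2]; ring
  obtain ⟨j, rfl⟩ : ∃ j, k = j + 1 := ⟨k - 1, by omega⟩
  have h3 : ((j + 1 : ℕ) : ℝ⟦X⟧) * ((1 + X) ^ (4 * (j + 1)) * geom ^ (2 * (j + 1)))
      - X * PowerSeries.derivative ℝ ((1 + X) ^ (4 * (j + 1)) * geom ^ (2 * (j + 1)))
      = PowerSeries.C ((j : ℝ) + 1) * ((1 - 6 * X + X ^ 2) *
        ((1 + X) ^ (4 * (j + 1) - 1) * geom ^ (2 * (j + 1) + 1))) := by
    have e1 : 4 * (j + 1) = (4 * j + 3) + 1 := by ring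
    have e2 : 2 * (j + 1) = (2 * j + 1) + 1 := by ring
    rw [Derivation.leibniz, Derivation.leibniz_pow, Derivation.leibniz_pow, hg, e1, e2]
    simp only [smul_eq_mul, nsmul_eq_mul, map_add, Nat.add_sub_cancel, derivative_X,
      Derivation.map_one_eq_zero]
    have h4 : geom ^ (2 * j + 1 + 1) = geom ^ (2 * j + 1 + 1) * (geom * (1 - X)) := by
      rw [geom_mul, mul_one]
    push_cast
    simp only [map_natCast, map_one]
    linear_combination ((j + 1 : ℝ⟦X⟧) * (1 + X) ^ (4 * j + 4)
      - X * (4 * j + 4) * (1 + X) ^ (4 * j + 3)) * h4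
  rw [h3, coeff_C_mul] at h
  exact (mul_eq_zero.1 h).resolve_left (by positivity)

/-- The same residue for `ψ = X/(1 - X)²`, where `X ψ'/ψ = (1 + X)/(1 - X)`. -/
theorem coeff_shadow_kernel (k : ℕ) (hk : 0 < k) :
    coeff k ((1 + X) * (1 - X) ^ (2 * k - 1) : ℝ⟦X⟧) = 0 := by
  have h := coeff_sub_X_mul_derivative k ((1 - X) ^ (2 * k))
  obtain ⟨j, rfl⟩ : ∃ j, k = j + 1 := ⟨k - 1, by omega⟩
  have h3 : ((j + 1 : ℕ) : ℝ⟦X⟧) * (1 - X) ^ (2 * (j + 1))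
      - X * PowerSeries.derivative ℝ ((1 - X) ^ (2 * (j + 1)))
      = PowerSeries.C ((j : ℝ) + 1) * ((1 + X) * (1 - X) ^ (2 * (j + 1) - 1)) := by
    have e2 : 2 * (j + 1) = (2 * j + 1) + 1 := by ring
    rw [Derivation.leibniz_pow, e2]
    simp only [smul_eq_mul, nsmul_eq_mul, map_sub, Nat.add_sub_cancel, derivative_X,
      Derivation.map_one_eq_zero]
    push_cast
    simp only [map_add, map_natCast, map_one]
    ring
  rw [h3, coeff_C_mul] at h
  exact (mul_eq_zero.1 h).resolve_left (by positivity)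

theorem altGeom_cancel {a b : ℕ} (h : b ≤ a) :
    (1 + X) ^ a * altGeom ^ b = (1 + X) ^ (a - b) := by
  obtain ⟨c, rfl⟩ := Nat.exists_eq_add_of_le h
  rw [Nat.add_sub_cancel_left, pow_add]
  linear_combination (1 + X) ^ c * altGeom_pow_mul b

theorem altGeom_cancel' {a b : ℕ} (h : a ≤ b) :
    (1 + X) ^ a * altGeom ^ b = altGeom ^ (b - a) := by
  obtain ⟨c, rfl⟩ := Nat.exists_eq_add_of_le h
  rw [Nat.add_sub_cancel_left, pow_add]
  linear_combination altGeom ^ c * altGeom_pow_mul a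

theorem geom_cancel {a b : ℕ} (h : b ≤ a) :
    (1 - X) ^ a * geom ^ b = (1 - X) ^ (a - b) := by
  obtain ⟨c, rfl⟩ := Nat.exists_eq_add_of_le h
  rw [Nat.add_sub_cancel_left, pow_add]
  linear_combination (1 - X) ^ c * geom_pow_mul b

theorem geom_cancel' {a b : ℕ} (h : a ≤ b) :
    (1 - X) ^ a * geom ^ b = geom ^ (b - a) := by
  obtain ⟨c, rfl⟩ := Nat.exists_eq_add_of_le h
  rw [Nat.add_sub_cancel_left, pow_add]
  linear_combination geom ^ c * geom_pow_mul a

theorem constantCoeff_geom : constantCoeff geom = 1 := by simp [geom]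

theorem constantCoeff_altGeom : constantCoeff altGeom = 1 := by simp [altGeom]

/-- Lagrange inversion for the expansion of an invariant in the basic invariants. -/
theorem coeff_gleason_sum (n M i : ℕ) (a : ℕ → ℝ) (hM : i < M) (hi : 4 * i ≤ n) :
    coeff i ((1 - 6 * X + X ^ 2) *
      (∑ j ∈ Finset.range M, C (a j) * (1 + X) ^ (n - 4 * j) * (X * (1 - X) ^ 2) ^ j) *
      (altGeom ^ (n + 1 - 4 * i) * geom ^ (2 * i + 1))) = a i := by
  -- The sum is `(1 + X)^n ∑ a_j φ^j`, and the remaining factors amount to dividing by `(1 + X)^n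
  -- φ^i` and multiplying by `X φ'/φ`. Terms with `j > i` start in too high a degree; terms with `j
  -- < i` are killed by `coeff_kernel`.
  rw [Finset.mul_sum, Finset.sum_mul, map_sum, Finset.sum_eq_single_of_mem i
    (Finset.mem_range.2 hM)]
  · have e : (1 - 6 * X + X ^ 2) * (C (a i) * (1 + X) ^ (n - 4 * i) * (X * (1 - X) ^ 2) ^ i) *
        (altGeom ^ (n + 1 - 4 * i) * geom ^ (2 * i + 1))
        = C (a i) * ((1 - 6 * X + X ^ 2) * (altGeom * geom)) * X ^ i := by
      have h1 := altGeom_cancel' (show n - 4 * i ≤ n + 1 - 4 * i by omega)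
      have h2 := geom_cancel' (show 2 * i ≤ 2 * i + 1 by omega)
      rw [show n + 1 - 4 * i - (n - 4 * i) = 1 by omega, pow_one] at h1
      rw [show 2 * i + 1 - 2 * i = 1 by omega, pow_one] at h2
      trans C (a i) * ((1 - 6 * X + X ^ 2) *
        (((1 + X) ^ (n - 4 * i) * altGeom ^ (n + 1 - 4 * i)) *
          ((1 - X) ^ (2 * i) * geom ^ (2 * i + 1)))) * X ^ i
      · rw [mul_pow, ← pow_mul]
        ring
      · rw [h1, h2]
    rw [e, coeff_mul_X_pow', if_pos le_rfl, Nat.sub_self, coeff_zero_eq_constantCoeff_apply]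
    simp [constantCoeff_geom, constantCoeff_altGeom]
  · intro j _ hj
    rcases lt_or_gt_of_ne hj with h | h
    · have e : (1 - 6 * X + X ^ 2) * (C (a j) * (1 + X) ^ (n - 4 * j) * (X * (1 - X) ^ 2) ^ j) *
          (altGeom ^ (n + 1 - 4 * i) * geom ^ (2 * i + 1))
          = C (a j) * ((1 - 6 * X + X ^ 2) *
            ((1 + X) ^ (4 * (i - j) - 1) * geom ^ (2 * (i - j) + 1))) * X ^ j := by
        have h1 := altGeom_cancel (show n + 1 - 4 * i ≤ n - 4 * j by omega)
        have h2 := geom_cancel' (show 2 * j ≤ 2 * i + 1 by omega)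
        rw [show n - 4 * j - (n + 1 - 4 * i) = 4 * (i - j) - 1 by omega] at h1
        rw [show 2 * i + 1 - 2 * j = 2 * (i - j) + 1 by omega] at h2
        rw [← h1, ← h2, mul_pow, ← pow_mul]
        ring
      rw [e, coeff_mul_X_pow', if_pos h.le, coeff_C_mul, coeff_kernel _ (by omega), mul_zero]
    · have e : (1 - 6 * X + X ^ 2) * (C (a j) * (1 + X) ^ (n - 4 * j) * (X * (1 - X) ^ 2) ^ j) *
          (altGeom ^ (n + 1 - 4 * i) * geom ^ (2 * i + 1))
          = (1 - 6 * X + X ^ 2) * (C (a j) * (1 + X) ^ (n - 4 * j) * ((1 - X) ^ 2) ^ j) *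
          (altGeom ^ (n + 1 - 4 * i) * geom ^ (2 * i + 1)) * X ^ j := by
        rw [mul_pow]
        ring
      rw [e, coeff_mul_X_pow', if_neg (by omega)]

/-- Lagrange inversion for the expansion of a shadow enumerator. -/
theorem coeff_shadow_sum (J i : ℕ) (e : ℕ → ℝ) (hi : i ≤ J) :
    coeff i ((1 + X) *
      (∑ j ∈ Finset.range (J + 1), C (e j) * X ^ j * (1 - X) ^ (2 * J - 2 * j)) *
      geom ^ (2 * J - 2 * i + 1)) = e i := by
  rw [Finset.mul_sum, Finset.sum_mul, map_sum, Finset.sum_eq_single_of_mem i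
    (Finset.mem_range.2 (by omega))]
  · have h2 := geom_cancel' (show 2 * J - 2 * i ≤ 2 * J - 2 * i + 1 by omega)
    rw [Nat.add_sub_cancel_left, pow_one] at h2
    have h : (1 + X) * (C (e i) * X ^ i * (1 - X) ^ (2 * J - 2 * i)) *
        geom ^ (2 * J - 2 * i + 1) = C (e i) * ((1 + X) * geom) * X ^ i := by
      trans C (e i) * ((1 + X) *
        ((1 - X) ^ (2 * J - 2 * i) * geom ^ (2 * J - 2 * i + 1))) * X ^ i
      · ring
      · rw [h2]
    rw [h, coeff_mul_X_pow', if_pos le_rfl, Nat.sub_self, coeff_zero_eq_constantCoeff_apply]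
    simp [constantCoeff_geom]
  · intro j hjr hj
    rw [Finset.mem_range] at hjr
    rcases lt_or_gt_of_ne hj with h | h
    · have h2 := geom_cancel (show 2 * J - 2 * i + 1 ≤ 2 * J - 2 * j by omega)
      rw [show 2 * J - 2 * j - (2 * J - 2 * i + 1) = 2 * (i - j) - 1 by omega] at h2
      have h' : (1 + X) * (C (e j) * X ^ j * (1 - X) ^ (2 * J - 2 * j)) *
          geom ^ (2 * J - 2 * i + 1) = C (e j) * ((1 + X) * (1 - X) ^ (2 * (i - j) - 1)) * X ^ j := by
        rw [← h2]
        ring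
      rw [h', coeff_mul_X_pow', if_pos h.le, coeff_C_mul, coeff_shadow_kernel _ (by omega),
        mul_zero]
    · have h' : (1 + X) * (C (e j) * X ^ j * (1 - X) ^ (2 * J - 2 * j)) *
          geom ^ (2 * J - 2 * i + 1) = (1 + X) * (C (e j) * (1 - X) ^ (2 * J - 2 * j)) *
          geom ^ (2 * J - 2 * i + 1) * X ^ j := by
        ring
      rw [h', coeff_mul_X_pow', if_neg (by omega)]

end PowerSeries

end GleasonExpansion

namespace GleasonExpansion

/-! ### Explicit values of the extracted coefficients. -/

section Coefficients

open PowerSeries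

theorem coeff_mul_of_coeff_eq_zero (m : ℕ) (Q K : ℝ⟦X⟧) (h0 : coeff 0 Q = 1)
    (hQ : ∀ i, 0 < i → i ≤ m → coeff i Q = 0) : coeff m (Q * K) = coeff m K := by
  rw [coeff_mul, Finset.sum_eq_single_of_mem (0, m) (by simp)]
  · rw [h0, one_mul]
  · rintro ⟨p, q⟩ hpq hne
    rw [Finset.HasAntidiagonal.mem_antidiagonal] at hpq
    dsimp only at hpq ⊢
    rw [hQ p _ (by omega), zero_mul]
    rcases Nat.eq_zero_or_pos p with rfl | h
    · exact absurd (by rw [← hpq, zero_add]) hne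
    · exact h

/-- Making the two exponents equal leaves an even power series times a polynomial, so the parity of
the index selects the contributing terms. -/
theorem geom_pow_eq (d : ℕ) : altGeom ^ d * geom ^ (d + 2) =
    (geom * altGeom) ^ (d + 2) * (1 + 2 * X + X ^ 2) := by
  rw [mul_pow]
  linear_combination (-altGeom ^ d * geom ^ (d + 2)) * altGeom_pow_mul 2

theorem coeff_odd_kernel (d k : ℕ) :
    coeff (2 * k + 1) (altGeom ^ d * geom ^ (d + 2)) = 2 * coeff k (geom ^ (d + 2)) := by
  have e : altGeom ^ d * geom ^ (d + 2) = (geom * altGeom) ^ (d + 2)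
      + C 2 * ((geom * altGeom) ^ (d + 2) * X) + (geom * altGeom) ^ (d + 2) * X ^ 2 := by
    rw [geom_pow_eq, show (C 2 : ℝ⟦X⟧) = 2 from map_ofNat _ 2]
    ring
  rw [e, map_add, map_add, coeff_C_mul, coeff_succ_mul_X, coeff_geom_mul_altGeom_pow_even,
    coeff_geom_mul_altGeom_pow_odd, coeff_mul_X_pow']
  split_ifs with h
  · obtain ⟨l, rfl⟩ : ∃ l, k = l + 1 := ⟨k - 1, by omega⟩
    rw [show 2 * (l + 1) + 1 - 2 = 2 * l + 1 by omega, coeff_geom_mul_altGeom_pow_odd]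
    ring
  · ring

theorem coeff_even_kernel (d k : ℕ) :
    coeff (2 * (k + 1)) (altGeom ^ d * geom ^ (d + 2)) =
      coeff (k + 1) (geom ^ (d + 2)) + coeff k (geom ^ (d + 2)) := by
  have e : altGeom ^ d * geom ^ (d + 2) = (geom * altGeom) ^ (d + 2)
      + C 2 * ((geom * altGeom) ^ (d + 2) * X) + (geom * altGeom) ^ (d + 2) * X ^ 2 := by
    rw [geom_pow_eq, show (C 2 : ℝ⟦X⟧) = 2 from map_ofNat _ 2]
    ring
  rw [e, map_add, map_add, coeff_geom_mul_altGeom_pow_even, coeff_C_mul,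
    show 2 * (k + 1) = (2 * k + 1) + 1 by ring, coeff_succ_mul_X, coeff_geom_mul_altGeom_pow_odd,
    coeff_mul_X_pow', if_pos (by omega), show 2 * k + 1 + 1 - 2 = 2 * k by omega,
    coeff_geom_mul_altGeom_pow_even]
  ring

/-- The coefficients of `(1 + X) / (1 - X) ^ (d + 1)`. -/
noncomputable def palCoeff (d k : ℕ) : ℝ := coeff k ((1 + X) * geom ^ (d + 1))

theorem palCoeff_succ (d k : ℕ) :
    palCoeff d (k + 1) = ((d + k + 1).choose d : ℝ) + ((d + k).choose d : ℝ) := by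
  rw [palCoeff, add_mul, one_mul, map_add, coeff_succ_X_mul, coeff_geom_pow, coeff_geom_pow]
  rfl

theorem palCoeff_zero (d : ℕ) : palCoeff d 0 = 1 := by
  simp [palCoeff, constantCoeff_geom]

theorem palCoeff_pos (d k : ℕ) : 0 < palCoeff d k := by
  cases k with
  | zero => simp [palCoeff_zero]
  | succ k =>
    rw [palCoeff_succ]
    have : 0 < (d + k).choose d := Nat.choose_pos (by omega)
    positivity

/-- Links the parameters `d` and `d + 2`, which occur in the expansions of two neighbouring shadow
coefficients, and so lets these be combined term by term. -/
theorem palCoeff_step (d k : ℕ) : ((k : ℝ) + 1) * (d + k + 1) * palCoeff d (k + 1) =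
    (d + 1) * (d + 2) * palCoeff (d + 2) k := by
  have hc : ∀ a b : ℕ, ((a + b).choose a : ℝ) = (a + b).factorial / (a.factorial * b.factorial) :=
    fun a b => Nat.cast_add_choose ℝ
  have hf : ∀ a : ℕ, ((a + 1).factorial : ℝ) = (a + 1) * a.factorial := fun a => by
    rw [Nat.factorial_succ]; push_cast; ring
  cases k with
  | zero =>
    rw [palCoeff_zero, palCoeff_succ, show d + 0 + 1 = d + 1 from rfl, hc, hc, hf]
    have := Nat.factorial_pos d
    field_simp
    push_cast
    simp
    ring
  | succ k =>
    rw [palCoeff_succ, palCoeff_succ, show d + (k + 1) + 1 = d + (k + 2) by ring,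
      show d + 2 + k + 1 = (d + 2) + (k + 1) by ring, hc, hc, hc, hc,
      show d + (k + 2) = d + k + 1 + 1 by ring, show d + (k + 1) = d + k + 1 by ring,
      show d + 2 + (k + 1) = d + k + 1 + 1 + 1 by ring, show d + 2 + k = d + k + 1 + 1 by ring,
      hf (d + k + 1 + 1), hf (d + k + 1), hf (d + k), hf (k + 1), hf k, hf (d + 1), hf d]
    have := Nat.factorial_pos d
    have := Nat.factorial_pos k
    push_cast
    field_simp
    ring

/-- The coefficient governing the last free invariant in the first case of Rains' bound. -/
theorem coeff_rains_even (m : ℕ) (hm : 0 < m) :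
    coeff (2 * m) ((1 - 6 * X + X ^ 2) * (altGeom ^ (4 * m + 1) * geom ^ (4 * m + 1))) =
      palCoeff (4 * m) m := by
  obtain ⟨k, rfl⟩ : ∃ k, m = k + 1 := ⟨m - 1, by omega⟩
  set d := 4 * (k + 1) + 1
  have e : (1 - 6 * X + X ^ 2) * (altGeom ^ d * geom ^ d) = (geom * altGeom) ^ d
      - C 6 * ((geom * altGeom) ^ d * X) + (geom * altGeom) ^ d * X ^ 2 := by
    rw [mul_pow, show (C 6 : ℝ⟦X⟧) = 6 from map_ofNat _ 6]
    ring
  rw [e, map_add, map_sub, coeff_geom_mul_altGeom_pow_even, coeff_C_mul,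
    show 2 * (k + 1) = (2 * k + 1) + 1 by ring, coeff_succ_mul_X, coeff_geom_mul_altGeom_pow_odd,
    coeff_mul_X_pow', if_pos (by omega), show 2 * k + 1 + 1 - 2 = 2 * k by omega,
    coeff_geom_mul_altGeom_pow_even, palCoeff, add_mul, one_mul, map_add, coeff_succ_X_mul]
  ring

theorem coeff_rains_odd (m : ℕ) (hm : 0 < m) :
    coeff (2 * m + 1) ((1 - 6 * X + X ^ 2) * (altGeom ^ (4 * m - 3) * geom ^ (4 * m + 3))) =
      -64 * palCoeff (4 * m + 2) (m - 1) := by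
  obtain ⟨k, rfl⟩ : ∃ k, m = k + 1 := ⟨m - 1, by omega⟩
  rw [show 4 * (k + 1) - 3 = 4 * k + 1 by omega, show 4 * (k + 1) + 3 = 4 * k + 1 + 6 by ring,
    Nat.add_sub_cancel, palCoeff, show 4 * (k + 1) + 2 + 1 = 4 * k + 1 + 6 by ring]
  set d := 4 * k + 1
  set F := (geom * altGeom) ^ (d + 6) with hF
  have e : (1 - 6 * X + X ^ 2) * (altGeom ^ d * geom ^ (d + 6)) =
      F * ((1 - 6 * X + X ^ 2) * (1 + X) ^ 6) := by
    rw [hF, mul_pow]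
    linear_combination (-altGeom ^ d * geom ^ (d + 6) * (1 - 6 * X + X ^ 2)) * altGeom_pow_mul 6
  -- `F` is even, so only the odd part `-64 (X³ + X⁵)` matters; its factor cancels the `-1/64` of
  -- `shadowCoeff`.
  have e2 : F * ((1 - 6 * X + X ^ 2) * (1 + X) ^ 6) = F - C 20 * (F * X ^ 2) - C 64 * (F * X ^ 3)
      - C 90 * (F * X ^ 4) - C 64 * (F * X ^ 5) - C 20 * (F * X ^ 6) + F * X ^ 8 := by
    have h (n : ℕ) [n.AtLeastTwo] : (C (OfNat.ofNat n) : ℝ⟦X⟧) = OfNat.ofNat n := map_ofNat _ n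
    rw [h 20, h 64, h 90]
    ring
  have ho : ∀ j, coeff (2 * (k + 1) + 1) (F * X ^ (2 * j)) = 0 := by
    intro j
    rw [coeff_mul_X_pow']
    split_ifs with h
    · rw [show 2 * (k + 1) + 1 - 2 * j = 2 * (k + 1 - j) + 1 by omega, hF,
        coeff_geom_mul_altGeom_pow_odd]
    · rfl
  have h0 := ho 0
  rw [mul_zero, pow_zero, mul_one] at h0
  rw [e, e2]
  simp only [map_sub, map_add, coeff_C_mul, h0, ho 1, ho 2, ho 3, ho 4]
  rw [coeff_mul_X_pow', if_pos (by omega),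
    show 2 * (k + 1) + 1 - 3 = 2 * k by omega, hF, coeff_geom_mul_altGeom_pow_even,
    add_mul, one_mul, map_add, coeff_mul_X_pow']
  cases k with
  | zero => simp
  | succ k =>
    rw [if_pos (by omega), show 2 * (k + 1 + 1) + 1 - 5 = 2 * k by omega,
      coeff_geom_mul_altGeom_pow_even, coeff_succ_X_mul]
    ring

end Coefficients

end GleasonExpansion

namespace GleasonExpansion

/-! ### Invariants against their shadows: numerical constraints. -/

section Polynomial

open Polynomial

/-- A combination of the basic invariants `1 + X` and `X (1 - X) ^ 2` of degrees `1` and `4`. -/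
noncomputable def invariantSum (n M : ℕ) (a : ℕ → ℝ) : ℝ[X] :=
  ∑ j ∈ Finset.range M, C (a j) * (1 + X) ^ (n - 4 * j) * (X * (1 - X) ^ 2) ^ j

/-- The combination of the shadows of the basic invariants. -/
noncomputable def shadowSum (J : ℕ) (e : ℕ → ℝ) : ℝ[X] :=
  ∑ j ∈ Finset.range (J + 1), C (e j) * X ^ j * (1 - X) ^ (2 * J - 2 * j)

theorem coe_invariantSum (n M : ℕ) (a : ℕ → ℝ) : (invariantSum n M a : PowerSeries ℝ) =
    ∑ j ∈ Finset.range M, PowerSeries.C (a j) * (1 + PowerSeries.X) ^ (n - 4 * j) *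
      (PowerSeries.X * (1 - PowerSeries.X) ^ 2) ^ j := by
  rw [invariantSum, ← Polynomial.coeToPowerSeries.ringHom_apply, map_sum]
  simp

theorem coe_shadowSum (J : ℕ) (e : ℕ → ℝ) : (shadowSum J e : PowerSeries ℝ) =
    ∑ j ∈ Finset.range (J + 1), PowerSeries.C (e j) * PowerSeries.X ^ j *
      (1 - PowerSeries.X) ^ (2 * J - 2 * j) := by
  rw [shadowSum, ← Polynomial.coeToPowerSeries.ringHom_apply, map_sum]
  simp

/-- The coefficients of the shadow of a combination of invariants. -/
noncomputable def shadowCoeff (J : ℕ) (a : ℕ → ℝ) (i : ℕ) : ℝ := (-1 / 64) ^ (J - i) * a (J - i)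

/-- Up to powers of `1 + y`, the substitution sends `1 + X` to `4y` and `X(1 - X)²` to `-4(1 -
y⁴)²`. Low powers of the second invariant thus give high powers of `y`, which is why the index is
reversed. -/
theorem eval_shadow_invariantSum (J r : ℕ) (a : ℕ → ℝ) (y : ℝ) (hy : 0 < y) :
    (1 + y) ^ (2 * (4 * J + r)) *
      (invariantSum (4 * J + r) (J + 1) a).eval (-((1 - y) / (1 + y)) ^ 2) =
      4 ^ (4 * J + r) * y ^ r * (shadowSum J (shadowCoeff J a)).eval (y ^ 4) := by
  have hy1 : 1 + y ≠ 0 := by positivity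
  rw [invariantSum, shadowSum, eval_finsetSum, eval_finsetSum, Finset.mul_sum, Finset.mul_sum,
    ← Finset.sum_range_reflect]
  refine Finset.sum_congr rfl fun j hj => ?_
  obtain ⟨k, rfl⟩ : ∃ k, J = j + k := ⟨J - j, by rw [Finset.mem_range] at hj; omega⟩
  simp only [eval_mul, eval_C, eval_pow, eval_add, eval_sub, eval_one, eval_X, shadowCoeff]
  rw [show j + k + 1 - 1 - j = k by omega, show j + k - j = k by omega,
    show 4 * (j + k) + r - 4 * k = 4 * j + r by omega,
    show 2 * (j + k) - 2 * j = 2 * k by omega]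
  have h1 : 1 + -((1 - y) / (1 + y)) ^ 2 = 4 * y / (1 + y) ^ 2 := by
    field_simp
    ring
  have h2 : -((1 - y) / (1 + y)) ^ 2 * (1 - -((1 - y) / (1 + y)) ^ 2) ^ 2 =
      4 ^ 4 * (-1 / 64) * (1 - y ^ 4) ^ 2 / (1 + y) ^ 8 := by
    field_simp
    ring
  rw [h1, h2, div_pow, div_pow, ← pow_mul, ← pow_mul]
  rw [show 2 * (4 * (j + k) + r) = 2 * (4 * j + r) + 8 * k by ring, pow_add (1 + y)]
  generalize (-1 / 64 : ℝ) = q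
  field_simp
  rw [mul_pow, mul_pow, mul_pow, ← pow_mul, ← pow_mul, ← pow_mul]
  ring

theorem coeff_of_eval_eq (W R : ℝ[X]) (r : ℕ)
    (h : ∀ y : ℝ, 0 < y → W.eval y = y ^ r * R.eval (y ^ 4)) (i : ℕ) :
    W.coeff (4 * i + r) = R.coeff i := by
  have hp : W = expand ℝ 4 R * X ^ r := by
    refine Polynomial.eq_of_infinite_eval_eq _ _ ((Set.Ioi_infinite (0 : ℝ)).mono fun y hy => ?_)
    rw [Set.mem_ofPred_eq, h y hy, eval_mul, expand_eval, eval_pow, eval_X, mul_comm]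
  rw [hp, coeff_mul_X_pow, mul_comm, coeff_expand_mul (by norm_num)]

/-- The factor `1 + X` of the inversion kernel is absorbed into the shadow, leaving natural number
weights; this gives the integrality in `semi_self_dual_restriction`. -/
theorem shadowCoeff_eq_sum (J i : ℕ) (e : ℕ → ℝ) (hi : i ≤ J) (d : ℕ)
    (hd : d = 2 * J - 2 * i) :
    e i = ∑ p ∈ Finset.HasAntidiagonal.antidiagonal i, ((1 + X) * shadowSum J e : ℝ[X]).coeff p.1 *
      ((d + p.2).choose d : ℝ) := by
  rw [← coeff_shadow_sum J i e hi, ← coe_shadowSum, ← hd]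
  have : (1 + PowerSeries.X) * (shadowSum J e : PowerSeries ℝ) =
      (((1 + X) * shadowSum J e : ℝ[X]) : PowerSeries ℝ) := by simp
  rw [this, PowerSeries.coeff_mul]
  simp only [Polynomial.coeff_coe, coeff_geom_pow]

/-- Here `1 + X` stays with the kernel, as suits a self-dual code, whose shadow has no such factor.
-/
theorem shadowCoeff_eq_sum' (J i : ℕ) (e : ℕ → ℝ) (hi : i ≤ J) (d : ℕ)
    (hd : d = 2 * J - 2 * i) :
    e i = ∑ p ∈ Finset.HasAntidiagonal.antidiagonal i, (shadowSum J e).coeff p.1 * palCoeff d p.2 := by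
  rw [← coeff_shadow_sum J i e hi, ← coe_shadowSum, ← hd, mul_assoc, mul_left_comm,
    PowerSeries.coeff_mul]
  simp only [Polynomial.coeff_coe, palCoeff]

/-- The enumerators of an extremal code of length `24 m` and of its
shadow force the shadow to contain the zero word. -/
theorem shadow_coeff_zero_ne_zero (m : ℕ) (hm : 0 < m) (a : ℕ → ℝ) (W : ℝ[X])
    (h0 : (invariantSum (12 * m) (3 * m + 1) a).coeff 0 = 1)
    (hQ : ∀ i, 0 < i → i ≤ 2 * m + 1 → (invariantSum (12 * m) (3 * m + 1) a).coeff i = 0)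
    (hpos : ∀ k, 0 ≤ W.coeff k)
    (hW : ∀ y : ℝ, 0 < y → 2 ^ (12 * m) * W.eval y = (1 + y) ^ (24 * m) *
      (invariantSum (12 * m) (3 * m + 1) a).eval (-((1 - y) / (1 + y)) ^ 2)) :
    W.coeff 0 ≠ 0 := by
  intro hW0
  set e := shadowCoeff (3 * m) a with he
  set c : ℝ := 2 ^ (12 * m) with hc
  have hcoeff : ∀ i, W.coeff (4 * i) = c * (shadowSum (3 * m) e).coeff i := by
    intro i
    rw [← coeff_C_mul]
    refine coeff_of_eval_eq W (C c * shadowSum (3 * m) e) 0 (fun y hy => ?_) i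
    have h1 := eval_shadow_invariantSum (3 * m) 0 a y hy
    have h2 := hW y hy
    rw [show 2 * (4 * (3 * m) + 0) = 24 * m by ring, show 4 * (3 * m) + 0 = 12 * m by ring] at h1
    rw [h1, show (4 : ℝ) = 2 ^ 2 by norm_num, ← pow_mul, mul_comm 2 (12 * m), pow_mul, ← hc,
      ← he] at h2
    have hc0 : c ≠ 0 := by positivity
    rw [eval_mul, eval_C]
    apply mul_left_cancel₀ hc0
    rw [h2]
    ring
  have hcQ0 : PowerSeries.coeff 0 (invariantSum (12 * m) (3 * m + 1) a : PowerSeries ℝ) = 1 := by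
    rw [Polynomial.coeff_coe, h0]
  have ha1 : a (2 * m) = palCoeff (4 * m) m := by
    rw [← coeff_rains_even m hm, ← coeff_gleason_sum (12 * m) (3 * m + 1) (2 * m) a (by omega)
      (by omega), ← coe_invariantSum, show 12 * m + 1 - 4 * (2 * m) = 4 * m + 1 by omega,
      show 2 * (2 * m) + 1 = 4 * m + 1 by ring, mul_comm (1 - 6 * PowerSeries.X + _), mul_assoc]
    exact coeff_mul_of_coeff_eq_zero _ _ _ hcQ0 fun i hi hi' => by
      rw [Polynomial.coeff_coe, hQ i hi (by omega)]
  have ha2 : a (2 * m + 1) = -64 * palCoeff (4 * m + 2) (m - 1) := by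
    rw [← coeff_rains_odd m hm, ← coeff_gleason_sum (12 * m) (3 * m + 1) (2 * m + 1) a (by omega)
      (by omega), ← coe_invariantSum, show 12 * m + 1 - 4 * (2 * m + 1) = 4 * m - 3 by omega,
      show 2 * (2 * m + 1) + 1 = 4 * m + 3 by ring, mul_comm (1 - 6 * PowerSeries.X + _),
      mul_assoc]
    exact coeff_mul_of_coeff_eq_zero _ _ _ hcQ0 fun i hi hi' => by
      rw [Polynomial.coeff_coe, hQ i hi (by omega)]
  have hc64 : c * (-1 / 64) ^ (2 * m) = 1 := by
    rw [hc, pow_mul, pow_mul, ← mul_pow]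
    norm_num
  have he1 : c * e m = palCoeff (4 * m) m := by
    rw [he, shadowCoeff, show 3 * m - m = 2 * m by omega, ← mul_assoc, hc64, one_mul, ha1]
  have he2 : c * e (m - 1) = palCoeff (4 * m + 2) (m - 1) := by
    rw [he, shadowCoeff, show 3 * m - (m - 1) = 2 * m + 1 by omega, ← mul_assoc, pow_succ,
      ← mul_assoc, hc64, ha2]
    ring
  have hs1 : palCoeff (4 * m) m =
      ∑ j ∈ Finset.range (m + 1), W.coeff (4 * j) * palCoeff (4 * m) (m - j) := by
    rw [← he1, shadowCoeff_eq_sum' (3 * m) m e (by omega) (4 * m) (by omega),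
      Finset.Nat.sum_antidiagonal_eq_sum_range_succ_mk, Finset.mul_sum]
    exact Finset.sum_congr rfl fun j _ => by rw [hcoeff]; ring
  have hs2 : palCoeff (4 * m + 2) (m - 1) =
      ∑ j ∈ Finset.range m, W.coeff (4 * j) * palCoeff (4 * m + 2) (m - 1 - j) := by
    rw [← he2, shadowCoeff_eq_sum' (3 * m) (m - 1) e (by omega) (4 * m + 2) (by omega),
      Finset.Nat.sum_antidiagonal_eq_sum_range_succ_mk, Finset.mul_sum,
      show (m - 1).succ = m by omega]
    exact Finset.sum_congr rfl fun j _ => by rw [hcoeff]; ring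
  have hstep : ∀ k : ℕ, 0 < k → (k : ℝ) * (4 * m + k) * palCoeff (4 * m) k =
      (4 * m + 1) * (4 * m + 2) * palCoeff (4 * m + 2) (k - 1) := by
    intro k hk
    obtain ⟨l, rfl⟩ : ∃ l, k = l + 1 := ⟨k - 1, by omega⟩
    have := palCoeff_step (4 * m) l
    push_cast at this ⊢
    linarith
  -- Combine `hs1` and `hs2` so that their left sides cancel by `hstep`. All terms become
  -- nonnegative, and the last factor vanishes only at `j = 0`; with no constant term the whole
  -- shadow sum in `hs1` would vanish.
  have key : ∑ j ∈ Finset.range (m + 1), W.coeff (4 * j) * palCoeff (4 * m) (m - j) *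
      (((m : ℝ) * (4 * m + m)) - ((m - j : ℕ) : ℝ) * (4 * m + (m - j : ℕ))) = 0 := by
    have e1 : ∑ j ∈ Finset.range (m + 1), W.coeff (4 * j) * palCoeff (4 * m) (m - j) *
        (((m : ℝ) * (4 * m + m)) - ((m - j : ℕ) : ℝ) * (4 * m + (m - j : ℕ))) =
        (m : ℝ) * (4 * m + m) *
          ∑ j ∈ Finset.range (m + 1), W.coeff (4 * j) * palCoeff (4 * m) (m - j) -
        (4 * m + 1) * (4 * m + 2) *
          ∑ j ∈ Finset.range m, W.coeff (4 * j) * palCoeff (4 * m + 2) (m - 1 - j) := by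
      simp only [mul_sub, Finset.sum_sub_distrib]
      congr 1
      · rw [Finset.mul_sum]
        exact Finset.sum_congr rfl fun j _ => by ring
      · rw [Finset.sum_range_succ, Nat.sub_self, Nat.cast_zero, zero_mul, mul_zero, add_zero,
          Finset.mul_sum]
        refine Finset.sum_congr rfl fun j hj => ?_
        rw [Finset.mem_range] at hj
        have := hstep (m - j) (by omega)
        rw [show m - j - 1 = m - 1 - j by omega] at this
        linear_combination W.coeff (4 * j) * this
    rw [e1, ← hs1, ← hs2, hstep m hm, sub_self]
  have hterm := (Finset.sum_eq_zero_iff_of_nonneg (fun j hj => ?_)).1 key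
  · have hz : ∀ j ∈ Finset.range (m + 1), W.coeff (4 * j) = 0 := by
      intro j hj
      have h1 := hterm j hj
      rw [Finset.mem_range] at hj
      rcases Nat.eq_zero_or_pos j with rfl | hj0
      · exact hW0
      · rcases mul_eq_zero.1 h1 with h2 | h2
        · exact (mul_eq_zero.1 h2).resolve_right (palCoeff_pos _ _).ne'
        · exfalso
          rw [Nat.cast_sub (by omega)] at h2
          have h3 : (1 : ℝ) ≤ j := by exact_mod_cast hj0
          have h4 : (j : ℝ) ≤ m := by exact_mod_cast (by omega : j ≤ m)
          nlinarith
    have := palCoeff_pos (4 * m) m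
    rw [hs1, Finset.sum_eq_zero fun j hj => by rw [hz j hj, zero_mul]] at this
    exact lt_irrefl _ this
  · refine mul_nonneg (mul_nonneg (hpos _) (palCoeff_pos _ _).le) ?_
    have h5 : ((m - j : ℕ) : ℝ) ≤ m := by exact_mod_cast Nat.sub_le m j
    have h6 : (0 : ℝ) ≤ ((m - j : ℕ) : ℝ) := by positivity
    rw [sub_nonneg]
    gcongr

/-- The enumerators of a semi self-dual code and its dual of length `12 m` and dual distance at
least `2 m + 2`, together with the integrality of a shadow, restrict `m`. -/
theorem semi_self_dual_restriction (m : ℕ) (hm : 0 < m) (a : ℕ → ℝ) (W Q : ℝ[X]) (t : ℕ → ℕ)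
    (hQa : Q = (1 - 6 * X + X ^ 2) * invariantSum (6 * m - 2) ((3 * m + 1) / 2) a)
    (h0 : Q.coeff 0 = 1) (hQ : ∀ i, 0 < i → i ≤ m → Q.coeff i = 0)
    (ht : ∀ k, W.coeff k = t k)
    (hW : ∀ y : ℝ, 0 < y → 2 ^ (6 * m + 1) * W.eval y = (1 + y) ^ (12 * m) *
      Q.eval (-((1 - y) / (1 + y)) ^ 2)) :
    ¬ Odd m ∧ ∀ μ, m = 2 * μ → ¬ Odd ((5 * μ - 1).choose (μ - 1)) := by
  -- `J` and `r` are quotient and remainder of `6m - 2` by 4, so `r` is 0 for odd `m` and 2 for even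
  -- `m`.
  obtain ⟨J, hJ⟩ : ∃ J, (3 * m + 1) / 2 = J + 1 := ⟨(3 * m + 1) / 2 - 1, by omega⟩
  obtain ⟨r, hr⟩ : ∃ r, 6 * m - 2 = 4 * J + r := ⟨6 * m - 2 - 4 * J, by omega⟩
  have hmJ : m ≤ J := by omega
  rw [hJ] at hQa
  set e := shadowCoeff J a with he
  set c : ℝ := 2 ^ (6 * m - 2) with hc
  have hcoeff : ∀ i, (t (4 * i + r) : ℝ) = c * ((1 + X) * shadowSum J e : ℝ[X]).coeff i := by
    intro i
    rw [← coeff_C_mul, ← ht]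
    refine coeff_of_eval_eq W (C c * ((1 + X) * shadowSum J e)) r (fun y hy => ?_) i
    have hy1 : 1 + y ≠ 0 := by positivity
    have h1 := eval_shadow_invariantSum J r a y hy
    have h2 := hW y hy
    -- The shadow of the quartic is `8(1 + y⁴)`, the source of the factor `1 + X` in `hcoeff`.
    have h3 : 1 - 6 * -((1 - y) / (1 + y)) ^ 2 + (-((1 - y) / (1 + y)) ^ 2) ^ 2 =
        8 * (1 + y ^ 4) / (1 + y) ^ 4 := by
      field_simp
      ring
    rw [hQa, eval_mul, show 12 * m = 2 * (4 * J + r) + 4 by omega, pow_add (1 + y), hr] at h2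
    simp only [eval_add, eval_sub, eval_mul, eval_pow, eval_X, eval_one, eval_ofNat] at h2
    rw [h3] at h2
    have h4 : (1 + y) ^ (2 * (4 * J + r)) * (1 + y) ^ 4 * (8 * (1 + y ^ 4) / (1 + y) ^ 4 *
        (invariantSum (4 * J + r) (J + 1) a).eval (-((1 - y) / (1 + y)) ^ 2)) =
        8 * (1 + y ^ 4) * ((1 + y) ^ (2 * (4 * J + r)) *
          (invariantSum (4 * J + r) (J + 1) a).eval (-((1 - y) / (1 + y)) ^ 2)) := by
      field_simp
    rw [h4, h1, ← he] at h2
    have h5 : (4 : ℝ) ^ (4 * J + r) = c * c := by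
      rw [hc, ← hr, ← mul_pow]
      norm_num
    have h6 : (2 : ℝ) ^ (6 * m + 1) = 8 * c := by
      rw [hc, show 6 * m + 1 = 3 + (6 * m - 2) by omega, pow_add]
      norm_num
    rw [h5, h6] at h2
    have hc0 : 8 * c ≠ 0 := by positivity
    apply mul_left_cancel₀ hc0
    rw [h2]
    simp only [eval_add, eval_mul, eval_C, eval_one, eval_X]
    ring
  have ha : a m = PowerSeries.coeff m (altGeom ^ (2 * m - 1) * geom ^ (2 * m - 1 + 2)) := by
    rw [← coeff_gleason_sum (6 * m - 2) (J + 1) m a (by omega) (by omega), ← coe_invariantSum,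
      show 6 * m - 2 + 1 - 4 * m = 2 * m - 1 by omega, show 2 * m - 1 + 2 = 2 * m + 1 by omega]
    have hQ' : (1 - 6 * PowerSeries.X + PowerSeries.X ^ 2) *
        (invariantSum (6 * m - 2) (J + 1) a : PowerSeries ℝ) = (Q : PowerSeries ℝ) := by
      rw [hQa]
      simp only [Polynomial.coe_mul, Polynomial.coe_add, Polynomial.coe_sub, Polynomial.coe_one,
        Polynomial.coe_pow, Polynomial.coe_X]
      congr 4
      rw [← Polynomial.coeToPowerSeries.ringHom_apply, map_ofNat]
    rw [hQ']
    exact coeff_mul_of_coeff_eq_zero _ _ _ (by rw [Polynomial.coeff_coe, h0]) fun i hi hi' => by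
      rw [Polynomial.coeff_coe, hQ i hi hi']
  obtain ⟨s, hs⟩ : ∃ s : ℕ, c * e (J - m) = s := by
    refine ⟨∑ p ∈ Finset.HasAntidiagonal.antidiagonal (J - m), t (4 * p.1 + r) * (2 * m + p.2).choose (2 * m), ?_⟩
    rw [shadowCoeff_eq_sum J (J - m) e (by omega) (2 * m) (by omega), Finset.mul_sum]
    push_cast
    exact Finset.sum_congr rfl fun p _ => by rw [hcoeff]; ring
  have hs' : (-1) ^ m * a m = 4 * (s : ℝ) := by
    rw [← hs, he, shadowCoeff, show J - (J - m) = m by omega, div_pow]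
    have : (64 : ℝ) ^ m = 4 * c := by
      rw [hc, show (64 : ℝ) = 2 ^ 6 by norm_num, ← pow_mul,
        show 6 * m = 2 + (6 * m - 2) by omega, pow_add]
      norm_num
    rw [this]
    have hc0 : c ≠ 0 := by positivity
    field_simp
  rw [ha] at hs'
  constructor
  · rintro ⟨k, rfl⟩
    rw [coeff_odd_kernel, pow_succ, pow_mul, show 2 * (2 * k + 1) - 1 + 2 = 4 * k + 2 + 1 by omega,
      coeff_geom_pow] at hs'
    have h1 : 0 < (4 * k + 2 + k).choose (4 * k + 2) := Nat.choose_pos (by omega)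
    have h2 : (0 : ℝ) < (4 * k + 2 + k).choose (4 * k + 2) := by exact_mod_cast h1
    have h3 : (0 : ℝ) ≤ s := by positivity
    norm_num at hs'
    linarith
  · rintro μ rfl hodd
    obtain ⟨k, rfl⟩ : ∃ k, μ = k + 1 := ⟨μ - 1, by omega⟩
    set d := 4 * (k + 1) with hd
    rw [coeff_even_kernel, pow_mul, show 2 * (2 * (k + 1)) - 1 + 2 = d + 1 by omega,
      coeff_geom_pow, coeff_geom_pow] at hs'
    norm_num at hs'
    have h1 : (d + (k + 1)).choose d + (d + k).choose d = 4 * s := by exact_mod_cast hs'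
    have h2 : (d + (k + 1)).choose d * (k + 1) = (d + (k + 1)) * (d + k).choose d := by
      have := Nat.add_one_mul_choose_eq (d + k) k
      rw [Nat.choose_symm_add, Nat.choose_symm_add, show d + (k + 1) = d + k + 1 by ring]
      linarith
    -- With `d = 4μ` and `k + 1 = μ`, `h1` becomes `6 * choose (5μ - 1) (4μ) = 4s`, impossible for
    -- an odd binomial.
    have h3 : (d + (k + 1)).choose d = 5 * (d + k).choose d := by
      have h4 : d + (k + 1) = 5 * (k + 1) := by omega
      apply Nat.eq_of_mul_eq_mul_right (show 0 < k + 1 by omega)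
      rw [h2, h4]
      ring
    rw [show 5 * (k + 1) - 1 = d + k by omega, Nat.add_sub_cancel,
      ← Nat.choose_symm_add] at hodd
    obtain ⟨l, hl⟩ := hodd
    omega

end Polynomial

end GleasonExpansion

namespace GleasonExpansion

/-! ### Gleason's theorem by descent on the degree. -/

section Invariants

open Polynomial

/-- The substitution `(x, y) ↦ (x + y, x - y)` in the form `∑ Q_k x ^ (2 (n - k)) y ^ (2 k)`,
evaluated at `x = 1`. -/
noncomputable def hadamard (n : ℕ) (Q : ℝ[X]) : ℝ[X] :=
  ∑ k ∈ Finset.range (n + 1), C (Q.coeff k) * ((1 - X) ^ 2) ^ k * ((1 + X) ^ 2) ^ (n - k)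

/-- The polynomial `Q (y ^ 2)`, homogenised in degree `2 n`, is an eigenvector of the
substitution `(x, y) ↦ (x + y, x - y)`. -/
def IsSemiInvariant (n : ℕ) (c : ℝ) (Q : ℝ[X]) : Prop :=
  Q.natDegree ≤ n ∧ hadamard n Q = C c * expand ℝ 2 Q

theorem eval_hadamard {n : ℕ} {Q : ℝ[X]} (hQ : Q.natDegree ≤ n) {y : ℝ} (hy : 1 + y ≠ 0) :
    (hadamard n Q).eval y = (1 + y) ^ (2 * n) * Q.eval (((1 - y) / (1 + y)) ^ 2) := by
  rw [eval_eq_sum_range' (Nat.lt_succ_of_le hQ), hadamard, eval_finsetSum, Finset.mul_sum]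
  refine Finset.sum_congr rfl fun k hk => ?_
  obtain ⟨l, rfl⟩ : ∃ l, n = k + l := ⟨n - k, by rw [Finset.mem_range] at hk; omega⟩
  simp only [eval_mul, eval_C, eval_pow, eval_add, eval_sub, eval_one, eval_X]
  rw [Nat.add_sub_cancel_left, div_pow, div_pow, pow_mul, pow_add]
  field_simp

theorem IsSemiInvariant.eval_eq {n : ℕ} {c : ℝ} {Q : ℝ[X]} (h : IsSemiInvariant n c Q) {y : ℝ}
    (hy : 1 + y ≠ 0) :
    (1 + y) ^ (2 * n) * Q.eval (((1 - y) / (1 + y)) ^ 2) = c * Q.eval (y ^ 2) := by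
  rw [← eval_hadamard h.1 hy, h.2, eval_mul, eval_C, expand_eval]

/-- Infinitely many test points suffice; the range `y > 1` keeps `1 + y` and `1 - y²` nonzero, as
needed to cancel an invariant factor. -/
theorem isSemiInvariant_of_eval {n : ℕ} {c : ℝ} {Q : ℝ[X]} (hQ : Q.natDegree ≤ n)
    (h : ∀ y : ℝ, 1 < y →
      (1 + y) ^ (2 * n) * Q.eval (((1 - y) / (1 + y)) ^ 2) = c * Q.eval (y ^ 2)) :
    IsSemiInvariant n c Q := by
  refine ⟨hQ, Polynomial.eq_of_infinite_eval_eq _ _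
    ((Set.Ioi_infinite (1 : ℝ)).mono fun y hy => ?_)⟩
  rw [Set.mem_Ioi] at hy
  rw [Set.mem_ofPred_eq, eval_hadamard hQ (by positivity), h y hy, eval_mul, eval_C, expand_eval]

theorem IsSemiInvariant.sub_mul {n : ℕ} {c : ℝ} {P Q : ℝ[X]} (hP : IsSemiInvariant n c P)
    (hQ : IsSemiInvariant n c Q) (a : ℝ) : IsSemiInvariant n c (P - C a * Q) := by
  refine isSemiInvariant_of_eval ?_ fun y hy => ?_
  · exact (natDegree_sub_le _ _).trans (max_le hP.1 ((natDegree_C_mul_le _ _).trans hQ.1))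
  · simp only [eval_sub, eval_mul, eval_C]
    have hy' : 1 + y ≠ 0 := by positivity
    linear_combination hP.eval_eq hy' - a * hQ.eval_eq hy'

theorem isSemiInvariant_one_add_pow (n : ℕ) :
    IsSemiInvariant n (2 ^ n) ((1 + X) ^ n) := by
  refine isSemiInvariant_of_eval ?_ fun y hy => ?_
  · compute_degree
  · have hy' : 1 + y ≠ 0 := by positivity
    simp only [eval_pow, eval_add, eval_one, eval_X]
    rw [pow_mul, ← mul_pow, ← mul_pow]
    congr 1
    field_simp
    ring

/-- Homogenised, the quartic is the real part of `(x + iy)⁴`. The substitution turns `x + iy` into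
`(1 + i)(x - iy)`, and `(1 + i)⁴ = -4` supplies the sign. -/
theorem isSemiInvariant_quartic_mul (k : ℕ) :
    IsSemiInvariant (2 * (k + 1)) (-2 ^ (2 * (k + 1)))
      ((1 - 6 * X + X ^ 2) * (1 + X) ^ (2 * k)) := by
  refine isSemiInvariant_of_eval ?_ fun y hy => ?_
  · compute_degree
    omega
  · have hy' : 1 + y ≠ 0 := by positivity
    have h1 := (isSemiInvariant_one_add_pow (2 * k)).eval_eq hy'
    have h2 : (1 + y) ^ 4 * (1 - 6 * ((1 - y) / (1 + y)) ^ 2 + (((1 - y) / (1 + y)) ^ 2) ^ 2) =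
        -4 * (1 - 6 * y ^ 2 + (y ^ 2) ^ 2) := by
      field_simp
      ring
    simp only [eval_pow, eval_add, eval_one, eval_X, eval_mul, eval_sub, eval_ofNat] at h1 ⊢
    rw [show 2 * (2 * (k + 1)) = 4 + 2 * (2 * k) by ring, pow_add,
      show 2 * (k + 1) = 2 + 2 * k by ring, pow_add]
    calc _ = ((1 + y) ^ 4 *
          (1 - 6 * ((1 - y) / (1 + y)) ^ 2 + (((1 - y) / (1 + y)) ^ 2) ^ 2)) *
          ((1 + y) ^ (2 * (2 * k)) * (1 + ((1 - y) / (1 + y)) ^ 2) ^ (2 * k)) := by ring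
      _ = _ := by rw [h1, h2]; ring

/-- Differentiate the functional equation at `y = 1`: the argument `((1 - y)/(1 + y))²` has a double
zero there, and the derivative of the prefactor is multiplied by `Q(0) = 0`. -/
theorem IsSemiInvariant.derivative_eval_one {n : ℕ} {c : ℝ} {Q : ℝ[X]}
    (h : IsSemiInvariant n c Q) (hc : c ≠ 0) (h0 : Q.eval 0 = 0) :
    (derivative Q).eval 1 = 0 := by
  have hs : HasDerivAt (fun y : ℝ => ((1 - y) / (1 + y)) ^ 2) 0 1 := by
    have h1 : HasDerivAt (fun y : ℝ => (1 - y) / (1 + y))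
        ((-1 * (1 + 1) - (1 - 1) * 1) / (1 + 1) ^ 2) 1 :=
      ((hasDerivAt_id (1 : ℝ)).const_sub 1).div ((hasDerivAt_id (1 : ℝ)).const_add 1) (by norm_num)
    exact (h1.fun_pow 2).congr_deriv (by norm_num)
  have hL : HasDerivAt (fun y : ℝ => (1 + y) ^ (2 * n) * Q.eval (((1 - y) / (1 + y)) ^ 2)) 0 1 := by
    have h1 : HasDerivAt (fun y : ℝ => Q.eval (((1 - y) / (1 + y)) ^ 2)) 0 1 :=
      (HasDerivAt.comp (h₂ := fun x => Q.eval x) (1 : ℝ) (Q.hasDerivAt _) hs).congr_deriv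
        (mul_zero _)
    have h2 : HasDerivAt (fun y : ℝ => (1 + y) ^ (2 * n))
        ((2 * n : ℕ) * (1 + 1) ^ (2 * n - 1) * 1) 1 :=
      ((hasDerivAt_id (1 : ℝ)).const_add 1).fun_pow (2 * n)
    exact (h2.fun_mul h1).congr_deriv (by simp [h0])
  have hR : HasDerivAt (fun y : ℝ => c * Q.eval (y ^ 2)) (c * ((derivative Q).eval 1 * 2)) 1 := by
    have h1 : HasDerivAt (fun y : ℝ => y ^ 2) 2 1 := by simpa using hasDerivAt_pow 2 (1 : ℝ)
    have h2 := (Q.hasDerivAt ((1 : ℝ) ^ 2)).comp (1 : ℝ) h1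
    exact (h2.const_mul c).congr_deriv (by simp)
  have heq : (fun y : ℝ => c * Q.eval (y ^ 2)) =ᶠ[nhds 1]
      fun y : ℝ => (1 + y) ^ (2 * n) * Q.eval (((1 - y) / (1 + y)) ^ 2) := by
    filter_upwards [lt_mem_nhds (show (0 : ℝ) < 1 by norm_num)] with y hy
    exact (h.eval_eq (by positivity)).symm
  have := hR.unique (hL.congr_of_eventuallyEq heq)
  simpa [hc] using this

theorem cancel_basic_invariant {w p s t u v c q z : ℝ} (hne : q * z ≠ 0)
    (he : w * p * (s * t * u) = c * (q * z * v)) (e : p * (s * t) = 16 * (q * z)) :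
    w * u = c / 16 * v := by
  refine mul_left_cancel₀ hne ?_
  linear_combination he / 16 - w * u / 16 * e

theorem IsSemiInvariant.eq_zero_or_exists_eq_mul {n : ℕ} {c : ℝ} {Q : ℝ[X]}
    (h : IsSemiInvariant n c Q) (hc : c ≠ 0) (h0 : Q.coeff 0 = 0) :
    Q = 0 ∨ 4 ≤ n ∧ ∃ R, Q = X * (1 - X) ^ 2 * R ∧ IsSemiInvariant (n - 4) (c / 16) R := by
  by_cases hQ : Q = 0
  · exact Or.inl hQ
  right
  have h0' : Q.eval 0 = 0 := by rw [← coeff_zero_eq_eval_zero, h0]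
  have h1 : Q.eval 1 = 0 := by
    have := h.eval_eq (y := 1) (by norm_num)
    simpa [h0', hc] using this
  -- At `y = -1` only the top term of `hadamard` survives, so `Q(1) = 0` kills the top coefficient.
  -- This extra degree makes the quotient by the cubic `X(1 - X)²` have degree at most `n - 4`.
  have hn : Q.coeff n = 0 := by
    have := congrArg (eval (-1)) h.2
    rw [hadamard, eval_finsetSum, Finset.sum_eq_single_of_mem n (by simp)] at this
    · simpa [h1] using this
    · intro k hk hkn
      rw [Finset.mem_range] at hk
      simp only [eval_mul, eval_C, eval_pow, eval_add, eval_sub, eval_one, eval_X]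
      rw [add_neg_cancel, zero_pow two_ne_zero, zero_pow (by omega), mul_zero]
  have hd2 : (X - C 1) ^ 2 ∣ Q := by
    rw [← le_rootMultiplicity_iff hQ]
    exact (one_lt_rootMultiplicity_iff_isRoot hQ).2 ⟨h1, h.derivative_eval_one hc h0'⟩
  have hcop : IsCoprime (X : ℝ[X]) ((X - C 1) ^ 2) := by
    refine IsCoprime.pow_right ⟨1, -1, ?_⟩
    rw [C_1]
    ring
  obtain ⟨R, hR⟩ := hcop.mul_dvd (X_dvd_iff.2 h0) hd2
  have hR' : Q = X * (1 - X) ^ 2 * R := by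
    rw [hR, C_1]
    ring
  have hR0 : R ≠ 0 := by
    rintro rfl
    exact hQ (by rw [hR, mul_zero])
  have hdeg : Q.natDegree = 3 + R.natDegree := by
    rw [hR, natDegree_mul (by
      exact mul_ne_zero X_ne_zero (pow_ne_zero _ (X_sub_C_ne_zero 1))) hR0,
      natDegree_mul X_ne_zero (pow_ne_zero _ (X_sub_C_ne_zero 1)), natDegree_pow,
      natDegree_X_sub_C, natDegree_X]
  have hlt : Q.natDegree < n := by
    refine lt_of_le_of_ne h.1 fun he => hQ ?_
    rw [← leadingCoeff_eq_zero, leadingCoeff, he, hn]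
  have h4 : 4 ≤ n := by omega
  refine ⟨h4, R, hR', isSemiInvariant_of_eval (by omega) fun y hy => ?_⟩
  have hy' : 1 + y ≠ 0 := by positivity
  have hy0 : y ≠ 0 := by positivity
  have hy1 : 1 - y ^ 2 ≠ 0 := by nlinarith
  have he := h.eval_eq hy'
  rw [hR', show 2 * n = 2 * (n - 4) + 8 by omega, pow_add] at he
  simp only [eval_mul, eval_pow, eval_sub, eval_one, eval_X] at he
  have e1 : (1 + y) ^ 8 * (((1 - y) / (1 + y)) ^ 2 * (1 - ((1 - y) / (1 + y)) ^ 2) ^ 2) =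
      16 * (y ^ 2 * (1 - y ^ 2) ^ 2) := by
    field_simp
    ring
  have hne : y ^ 2 * (1 - y ^ 2) ^ 2 ≠ 0 := by positivity
  exact cancel_basic_invariant hne he e1

theorem invariantSum_succ (n M : ℕ) (a : ℕ → ℝ) : invariantSum n (M + 1) a =
    C (a 0) * (1 + X) ^ n + X * (1 - X) ^ 2 * invariantSum (n - 4) M fun j => a (j + 1) := by
  have h : ∀ j, C (a (j + 1)) * (1 + X) ^ (n - 4 * (j + 1)) * (X * (1 - X) ^ 2) ^ (j + 1) =
      X * (1 - X) ^ 2 * (C (a (j + 1)) * (1 + X) ^ (n - 4 - 4 * j) * (X * (1 - X) ^ 2) ^ j) := by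
    intro j
    rw [show n - 4 * (j + 1) = n - 4 - 4 * j by omega]
    ring
  rw [invariantSum, Finset.sum_range_succ', invariantSum, Finset.mul_sum,
    Finset.sum_congr rfl fun j _ => h j, mul_zero, Nat.sub_zero, pow_zero, mul_one, add_comm]

theorem invariantSum_zero (n M : ℕ) : invariantSum n M (fun _ => 0) = 0 := by
  simp [invariantSum]

/-- Gleason's theorem for the invariants of the weight enumerators of even self-dual codes. -/
theorem IsSemiInvariant.exists_eq_invariantSum (n : ℕ) : ∀ Q : ℝ[X], IsSemiInvariant n (2 ^ n) Q →
    ∃ a, Q = invariantSum n (n / 4 + 1) a := by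
  induction n using Nat.strong_induction_on with
  | _ n ih =>
    intro Q hQ
    have h := hQ.sub_mul (isSemiInvariant_one_add_pow n) (Q.coeff 0)
    rcases h.eq_zero_or_exists_eq_mul (by positivity)
      (by simp [coeff_zero_eq_eval_zero]) with h1 | ⟨h4, R, hR, hR'⟩
    · refine ⟨fun j => if j = 0 then Q.coeff 0 else 0, ?_⟩
      rw [invariantSum_succ]
      simp only [if_true, Nat.add_eq_zero_iff, one_ne_zero, and_false, if_false,
        invariantSum_zero, mul_zero, add_zero]
      exact sub_eq_zero.1 h1
    · have e : (2 : ℝ) ^ n / 16 = 2 ^ (n - 4) := by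
        rw [show n = n - 4 + 4 by omega, pow_add, Nat.add_sub_cancel]
        norm_num
      rw [e] at hR'
      obtain ⟨b, hb⟩ := ih (n - 4) (by omega) R hR'
      refine ⟨fun j => if j = 0 then Q.coeff 0 else b (j - 1), ?_⟩
      rw [invariantSum_succ]
      simp only [if_true, Nat.add_eq_zero_iff, one_ne_zero, and_false, if_false,
        Nat.add_sub_cancel]
      rw [show n / 4 = (n - 4) / 4 + 1 by omega, ← hb, ← hR]
      ring

/-- The analogue of Gleason's theorem for the relative invariants of sign `-1`. -/
theorem IsSemiInvariant.exists_eq_mul_invariantSum (k : ℕ) :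
    ∀ Q : ℝ[X], IsSemiInvariant (2 * k) (-2 ^ (2 * k)) Q →
    ∃ a, Q = (1 - 6 * X + X ^ 2) * invariantSum (2 * k - 2) ((k + 1) / 2) a := by
  induction k using Nat.strong_induction_on with
  | _ k ih =>
    intro Q hQ
    rcases Nat.eq_zero_or_pos k with rfl | hk
    · refine ⟨fun _ => 0, ?_⟩
      rw [invariantSum_zero, mul_zero]
      have h1 := hQ.eval_eq (y := 1) (by norm_num)
      rw [eq_C_of_natDegree_le_zero hQ.1] at h1 ⊢
      simp only [eval_C] at h1
      norm_num at h1
      rw [show Q.coeff 0 = 0 by linarith, C_0]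
    · obtain ⟨l, rfl⟩ : ∃ l, k = l + 1 := ⟨k - 1, by omega⟩
      have h := hQ.sub_mul (isSemiInvariant_quartic_mul l) (Q.coeff 0)
      have hl : 2 * (l + 1) - 2 = 2 * l := by omega
      have hl2 : (l + 1 + 1) / 2 = l / 2 + 1 := by omega
      rw [hl, hl2]
      rcases h.eq_zero_or_exists_eq_mul (neg_ne_zero.2 (by positivity))
        (by simp [coeff_zero_eq_eval_zero]) with h1 | ⟨h4, R, hR, hR'⟩
      · refine ⟨fun j => if j = 0 then Q.coeff 0 else 0, ?_⟩
        rw [invariantSum_succ]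
        simp only [if_true, Nat.add_eq_zero_iff, one_ne_zero, and_false, if_false,
          invariantSum_zero, mul_zero, add_zero]
        rw [sub_eq_zero.1 h1]
        simp [coeff_zero_eq_eval_zero]
        ring
      · obtain ⟨p, rfl⟩ : ∃ p, l = p + 1 := ⟨l - 1, by omega⟩
        have e : -(2 : ℝ) ^ (2 * (p + 1 + 1)) / 16 = -2 ^ (2 * p) := by
          rw [show 2 * (p + 1 + 1) = 2 * p + 4 by omega, pow_add]
          ring
        rw [e, show 2 * (p + 1 + 1) - 4 = 2 * p by omega] at hR'
        obtain ⟨b, hb⟩ := ih p (by omega) R hR'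
        refine ⟨fun j => if j = 0 then Q.coeff 0 else b (j - 1), ?_⟩
        rw [invariantSum_succ]
        simp only [if_true, Nat.add_eq_zero_iff, one_ne_zero, and_false, if_false,
          Nat.add_sub_cancel]
        rw [show 2 * (p + 1) - 4 = 2 * p - 2 by omega]
        rw [hb] at hR
        linear_combination hR

end Invariants

end GleasonExpansion

namespace BinaryCode

/-! ### Character sums, MacWilliams' identity and biduality. -/

section CharacterSums

open Finset
open scoped Classical

variable {ι : Type} [Fintype ι]

/-- The nontrivial additive character of `𝔽₂`. -/
noncomputable def sgn (a : ZMod 2) : ℝ := if a = 0 then 1 else -1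

theorem sgn_zero : sgn 0 = 1 := by simp [sgn]

theorem sgn_one : sgn 1 = -1 := by simp [sgn]

theorem zmod_two_cases (a : ZMod 2) : a = 0 ∨ a = 1 := by
  revert a
  decide

theorem sgn_add (a b : ZMod 2) : sgn (a + b) = sgn a * sgn b := by
  have h : (1 + 1 : ZMod 2) = 0 := by decide
  rcases zmod_two_cases a with rfl | rfl <;> rcases zmod_two_cases b with rfl | rfl <;>
    simp [sgn_zero, sgn_one, h]

theorem sgn_mul_self (a : ZMod 2) : sgn a * sgn a = 1 := by
  rcases zmod_two_cases a with rfl | rfl <;> simp [sgn_zero, sgn_one]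

theorem sgn_natCast (k : ℕ) : sgn (k : ZMod 2) = (-1) ^ k := by
  induction k with
  | zero => simp [sgn_zero]
  | succ k ih => rw [Nat.cast_succ, sgn_add, ih, sgn_one, pow_succ]

theorem sgn_sum {α : Type} (s : Finset α) (f : α → ZMod 2) :
    sgn (∑ i ∈ s, f i) = ∏ i ∈ s, sgn (f i) := by
  induction s using Finset.induction_on with
  | empty => simp [sgn_zero]
  | insert a s ha ih => rw [sum_insert ha, prod_insert ha, sgn_add, ih]

/-- The words of a code as a finite set. -/
noncomputable def words (V : BinaryCode ι) : Finset (ι → ZMod 2) := univ.filter (· ∈ V)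

theorem mem_words {V : BinaryCode ι} {v : ι → ZMod 2} : v ∈ words V ↔ v ∈ V := by
  simp [words]

theorem card_words_pos (V : BinaryCode ι) : 0 < (words V).card :=
  card_pos.2 ⟨0, mem_words.2 V.zero_mem⟩

theorem add_self_eq_zero' {ι : Type} (v : ι → ZMod 2) : v + v = 0 := by
  funext i
  exact CharTwo.add_self_eq_zero (v i)

theorem add_add_cancel_self {ι : Type} (v c : ι → ZMod 2) : v + c + c = v := by
  rw [add_assoc, add_self_eq_zero', add_zero]

theorem sum_words_add {V : BinaryCode ι} {c : ι → ZMod 2} (hc : c ∈ V) (f : (ι → ZMod 2) → ℝ) :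
    ∑ v ∈ words V, f (v + c) = ∑ v ∈ words V, f v :=
  sum_nbij' (· + c) (· + c) (fun _ hv => mem_words.2 (V.add_mem (mem_words.1 hv) hc))
    (fun _ hv => mem_words.2 (V.add_mem (mem_words.1 hv) hc))
    (fun _ _ => add_add_cancel_self _ c) (fun _ _ => add_add_cancel_self _ c) (fun _ _ => rfl)

/-- A sign character of a code sums to zero unless it is trivial. -/
theorem sum_words_character (V : BinaryCode ι) (f : (ι → ZMod 2) → ℝ)
    (hf : ∀ v ∈ V, ∀ w ∈ V, f (v + w) = f v * f w) (hsq : ∀ v ∈ V, f v * f v = 1) :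
    ∑ v ∈ words V, f v = if ∀ v ∈ V, f v = 1 then ((words V).card : ℝ) else 0 := by
  split_ifs with h
  · rw [sum_congr rfl fun v hv => h v (mem_words.1 hv)]
    simp
  · push Not at h
    obtain ⟨c, hc, hne⟩ := h
    have hc1 : f c = -1 := (mul_self_eq_one_iff.1 (hsq c hc)).resolve_left hne
    -- Translating by a word of sign -1 negates the sum.
    have h1 := sum_words_add hc f
    rw [sum_congr rfl fun v hv => hf v (mem_words.1 hv) c hc, hc1, ← sum_mul] at h1
    linarith

theorem sum_words_sgn (V : BinaryCode ι) (u : ι → ZMod 2) :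
    ∑ v ∈ words V, sgn (v ⬝ᵥ u) = if u ∈ V.dual then ((words V).card : ℝ) else 0 := by
  rw [sum_words_character V (fun v => sgn (v ⬝ᵥ u))
    (fun v _ w _ => by rw [add_dotProduct, sgn_add]) (fun v _ => sgn_mul_self _)]
  refine if_congr (forall₂_congr fun c _ => ?_) rfl rfl
  rcases zmod_two_cases (c ⬝ᵥ u) with h | h <;> rw [h]
  · simp [sgn_zero]
  · simp only [sgn_one, one_ne_zero, iff_false]
    norm_num

theorem pow_hammingNorm (y : ℝ) (u : ι → ZMod 2) :
    y ^ hammingNorm u = ∏ i, if u i = 0 then 1 else y := by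
  rw [prod_ite, prod_const_one, one_mul, prod_const, hammingNorm]

theorem sum_sgn_mul_pow (y : ℝ) (v : ι → ZMod 2) :
    ∑ u : ι → ZMod 2, sgn (v ⬝ᵥ u) * y ^ hammingNorm u =
      (1 + y) ^ (Fintype.card ι - hammingNorm v) * (1 - y) ^ hammingNorm v := by
  have h1 : ∀ u : ι → ZMod 2, sgn (v ⬝ᵥ u) * y ^ hammingNorm u =
      ∏ i, (sgn (v i * u i) * if u i = 0 then 1 else y) := fun u => by
    rw [dotProduct, sgn_sum, pow_hammingNorm, prod_mul_distrib]
  rw [sum_congr rfl fun u _ => h1 u]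
  have h2 := (prod_univ_sum (fun _ : ι => (univ : Finset (ZMod 2)))
    (fun i a => sgn (v i * a) * if a = 0 then 1 else y)).symm
  rw [Fintype.piFinset_univ] at h2
  rw [h2]
  have h3 : ∀ i, ∑ a : ZMod 2, (sgn (v i * a) * if a = 0 then 1 else y) =
      if v i = 0 then 1 + y else 1 - y := by
    intro i
    have hu : (univ : Finset (ZMod 2)) = {0, 1} := by decide
    rw [hu, sum_pair (by decide)]
    rcases zmod_two_cases (v i) with h | h <;> rw [h] <;> simp [sgn_zero, sgn_one]
    ring
  rw [prod_congr rfl fun i _ => h3 i, prod_ite, prod_const, prod_const]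
  have h4 : (univ.filter fun i => v i = 0).card = Fintype.card ι - hammingNorm v := by
    refine Nat.eq_sub_of_add_eq ?_
    rw [← card_univ, ← card_filter_add_card_filter_not (s := (univ : Finset ι)) (fun i => v i = 0),
      hammingNorm]
  rw [h4]
  rfl

theorem macWilliams (V : BinaryCode ι) (y : ℝ) :
    ∑ v ∈ words V, (1 + y) ^ (Fintype.card ι - hammingNorm v) * (1 - y) ^ hammingNorm v =
      (words V).card * ∑ u ∈ words V.dual, y ^ hammingNorm u := by
  rw [sum_congr rfl fun v _ => (sum_sgn_mul_pow y v).symm, sum_comm]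
  simp_rw [← sum_mul, sum_words_sgn]
  rw [show words V.dual = univ.filter (· ∈ V.dual) from rfl, sum_filter, mul_sum]
  refine sum_congr rfl fun u _ => ?_
  split_ifs <;> simp

theorem card_words_mul_card_words_dual (V : BinaryCode ι) :
    (words V).card * (words V.dual).card = 2 ^ Fintype.card ι := by
  have h := macWilliams V 1
  rw [sum_eq_single_of_mem 0 (mem_words.2 V.zero_mem)] at h
  · simp only [hammingNorm_zero, one_pow, sum_const, Nat.sub_zero, pow_zero] at h
    norm_num at h
    exact_mod_cast h.symm
  · intro v _ hv
    rw [sub_self, zero_pow (hammingNorm_ne_zero_iff.2 hv), mul_zero]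

theorem le_dual_dual (V : BinaryCode ι) : V ≤ V.dual.dual := fun v hv u hu => by
  rw [dotProduct_comm]
  exact hu v hv

theorem dual_anti {V W : BinaryCode ι} (h : V ≤ W) : W.dual ≤ V.dual :=
  fun _ hu c hc => hu c (h hc)

theorem eq_of_le_of_card_le {V W : BinaryCode ι} (h : V ≤ W)
    (hc : (words W).card ≤ (words V).card) : V = W := by
  have h1 := eq_of_subset_of_card_le (s := words V) (t := words W)
    (fun v hv => mem_words.2 (h (mem_words.1 hv))) hc
  ext v
  rw [← mem_words, h1, mem_words]

theorem dual_dual (V : BinaryCode ι) : V.dual.dual = V := by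
  refine (eq_of_le_of_card_le (le_dual_dual V) ?_).symm
  have h1 := card_words_mul_card_words_dual V
  have h2 := card_words_mul_card_words_dual V.dual
  have h3 : (words V.dual).card * (words V.dual.dual).card =
      (words V.dual).card * (words V).card := by
    rw [h2, ← h1, mul_comm]
  exact (Nat.eq_of_mul_eq_mul_left (card_words_pos _) h3).le

end CharacterSums

/-! ### Shadow transforms of even codes. -/

section Parity

open Finset
open scoped Classical

variable {ι : Type} [Fintype ι]

theorem exists_hammingNorm_add (u v : ι → ZMod 2) : ∃ c : ℕ, (c : ZMod 2) = u ⬝ᵥ v ∧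
    hammingNorm (u + v) + 2 * c = hammingNorm u + hammingNorm v := by
  refine ⟨∑ i, if u i ≠ 0 ∧ v i ≠ 0 then 1 else 0, ?_, ?_⟩
  · rw [Nat.cast_sum, dotProduct]
    refine sum_congr rfl fun i _ => ?_
    rcases zmod_two_cases (u i) with h | h <;> rcases zmod_two_cases (v i) with h' | h' <;>
      simp [h, h']
  · simp only [hammingNorm, card_filter, mul_sum, ← sum_add_distrib]
    refine sum_congr rfl fun i _ => ?_
    have h2 : (1 + 1 : ZMod 2) = 0 := by decide
    rcases zmod_two_cases (u i) with h | h <;> rcases zmod_two_cases (v i) with h' | h' <;>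
      simp [h, h', h2]

theorem natCast_hammingNorm (v : ι → ZMod 2) : (hammingNorm v : ZMod 2) = v ⬝ᵥ v := by
  rw [hammingNorm, card_filter, Nat.cast_sum, dotProduct]
  refine sum_congr rfl fun i _ => ?_
  rcases zmod_two_cases (v i) with h | h <;> simp [h]

theorem even_hammingNorm_iff (v : ι → ZMod 2) : Even (hammingNorm v) ↔ v ⬝ᵥ v = 0 := by
  rw [← natCast_hammingNorm, ZMod.natCast_eq_zero_iff_even]

/-- All weights of the code are even. -/
def IsEven (V : BinaryCode ι) : Prop := ∀ v ∈ V, Even (hammingNorm v)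

theorem isEven_of_le_dual {V : BinaryCode ι} (h : V ≤ V.dual) : V.IsEven :=
  fun v hv => (even_hammingNorm_iff v).2 (h hv v hv)

/-- The sign of half the weight of a word. -/
noncomputable def halfSgn (v : ι → ZMod 2) : ℝ := (-1) ^ (hammingNorm v / 2)

theorem halfSgn_mul_self (v : ι → ZMod 2) : halfSgn v * halfSgn v = 1 := by
  rw [halfSgn, ← mul_pow]
  norm_num

theorem halfSgn_add {u v : ι → ZMod 2} (hu : Even (hammingNorm u)) (hv : Even (hammingNorm v)) :
    halfSgn (u + v) = halfSgn u * halfSgn v * sgn (u ⬝ᵥ v) := by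
  obtain ⟨c, hc, h⟩ := exists_hammingNorm_add u v
  obtain ⟨a, ha⟩ := hu
  obtain ⟨b, hb⟩ := hv
  have h1 : hammingNorm u / 2 = a := by omega
  have h2 : hammingNorm v / 2 = b := by omega
  have h3 : hammingNorm (u + v) / 2 + c = a + b := by omega
  rw [halfSgn, halfSgn, halfSgn, h1, h2, ← hc, sgn_natCast, ← pow_add, ← h3, pow_add, mul_assoc,
    ← mul_pow]
  norm_num

/-- The shadow transform of a code. -/
noncomputable def shadowTransform (V : BinaryCode ι) (u : ι → ZMod 2) : ℝ :=
  ∑ v ∈ words V, halfSgn v * sgn (v ⬝ᵥ u)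

theorem halfSgn_mul_sgn_add {v w u : ι → ZMod 2} (hv : Even (hammingNorm v))
    (hw : Even (hammingNorm w)) : halfSgn (v + w) * sgn ((v + w) ⬝ᵥ u) =
      (halfSgn v * sgn (v ⬝ᵥ u)) * (halfSgn w * sgn (w ⬝ᵥ u)) * sgn (v ⬝ᵥ w) := by
  rw [halfSgn_add hv hw, add_dotProduct, sgn_add]
  ring

theorem halfSgn_mul_sgn_mul_self (v u : ι → ZMod 2) :
    halfSgn v * sgn (v ⬝ᵥ u) * (halfSgn v * sgn (v ⬝ᵥ u)) = 1 := by
  rw [mul_mul_mul_comm, halfSgn_mul_self, sgn_mul_self, one_mul]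

/-- On a self-orthogonal code the cocycle in `halfSgn_add` is trivial, so the summand is a
character. -/
theorem shadowTransform_of_le_dual {V : BinaryCode ι} (h : V ≤ V.dual) (u : ι → ZMod 2) :
    shadowTransform V u =
      if ∀ v ∈ V, halfSgn v * sgn (v ⬝ᵥ u) = 1 then ((words V).card : ℝ) else 0 := by
  have he := isEven_of_le_dual h
  refine sum_words_character V (fun v => halfSgn v * sgn (v ⬝ᵥ u)) (fun v hv w hw => ?_)
    (fun v _ => halfSgn_mul_sgn_mul_self v u)
  rw [halfSgn_mul_sgn_add (he v hv) (he w hw), h hw v hv, sgn_zero, mul_one]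

/-- A quadratic Gauss sum: after translating one variable by the other, summing the pairing over
`V.dual` retains only its radical `V`. -/
theorem shadowTransform_dual_sq {V : BinaryCode ι} (hV : V ≤ V.dual) (he : V.dual.IsEven)
    (u : ι → ZMod 2) :
    shadowTransform V.dual u * shadowTransform V.dual u =
      (words V.dual).card * shadowTransform V u := by
  have h1 : ∀ v ∈ words V.dual, halfSgn v * sgn (v ⬝ᵥ u) * shadowTransform V.dual u =
      ∑ w ∈ words V.dual, halfSgn w * sgn (w ⬝ᵥ u) * sgn (v ⬝ᵥ w) := by
    intro v hv
    rw [mem_words] at hv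
    rw [shadowTransform, ← sum_words_add hv, mul_sum]
    refine sum_congr rfl fun w hw => ?_
    rw [mem_words] at hw
    rw [halfSgn_mul_sgn_add (he w hw) (he v hv), dotProduct_comm v w]
    linear_combination (halfSgn w * sgn (w ⬝ᵥ u) * sgn (w ⬝ᵥ v)) * halfSgn_mul_sgn_mul_self v u
  conv_lhs => enter [1]; rw [shadowTransform]
  rw [sum_mul, sum_congr rfl h1, sum_comm]
  simp_rw [← mul_sum, sum_words_sgn, dual_dual]
  rw [shadowTransform, mul_sum]
  simp only [mul_ite, mul_zero]
  rw [← sum_filter]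
  refine sum_congr ?_ fun w _ => mul_comm _ _
  ext w
  rw [mem_filter, mem_words, mem_words]
  exact ⟨fun h => h.2, fun h => ⟨hV h, h⟩⟩

theorem sum_shadowTransform_mul_pow (V : BinaryCode ι) (y : ℝ) :
    ∑ u : ι → ZMod 2, shadowTransform V u * y ^ hammingNorm u =
      ∑ v ∈ words V, halfSgn v *
        ((1 + y) ^ (Fintype.card ι - hammingNorm v) * (1 - y) ^ hammingNorm v) := by
  simp_rw [shadowTransform, sum_mul]
  rw [sum_comm]
  refine sum_congr rfl fun v _ => ?_
  rw [← sum_sgn_mul_pow, mul_sum]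
  exact sum_congr rfl fun u _ => by ring

end Parity

end BinaryCode

namespace BinaryCode

/-! ### Weight enumerators of extremal and of semi self-dual codes. -/

section Enumerators

open Finset Polynomial GleasonExpansion
open scoped Classical

variable {ι : Type} [Fintype ι]

/-- The weight enumerator of an even code in the variable `X = y ^ 2`. -/
noncomputable def halfEnum (V : BinaryCode ι) : ℝ[X] :=
  ∑ v ∈ words V, X ^ (hammingNorm v / 2)

/-- The weight enumerator of a set of words. -/
noncomputable def weightEnum (T : Finset (ι → ZMod 2)) : ℝ[X] := ∑ v ∈ T, X ^ hammingNorm v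

theorem eval_weightEnum (T : Finset (ι → ZMod 2)) (y : ℝ) :
    (weightEnum T).eval y = ∑ v ∈ T, y ^ hammingNorm v := by
  simp [weightEnum, eval_finsetSum]

theorem coeff_weightEnum (T : Finset (ι → ZMod 2)) (k : ℕ) :
    (weightEnum T).coeff k = ((T.filter fun v => k = hammingNorm v).card : ℝ) := by
  simp [weightEnum, coeff_X_pow]

theorem natDegree_halfEnum_le (V : BinaryCode ι) {n : ℕ} (hn : Fintype.card ι = 2 * n) :
    (halfEnum V).natDegree ≤ n := by
  refine natDegree_sum_le_of_forall_le _ _ fun v _ => ?_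
  rw [natDegree_X_pow]
  have : hammingNorm v ≤ Fintype.card ι := hammingNorm_le_card_fintype
  omega

theorem coeff_zero_halfEnum {V : BinaryCode ι} (h : ∀ v ∈ V, v ≠ 0 → 2 ≤ hammingNorm v) :
    (halfEnum V).coeff 0 = 1 := by
  rw [halfEnum, finsetSum_coeff, sum_eq_single_of_mem 0 (mem_words.2 V.zero_mem)]
  · simp
  · intro v hv hv0
    have := h v (mem_words.1 hv) hv0
    rw [coeff_X_pow, if_neg (by omega)]

theorem coeff_halfEnum_eq_zero {V : BinaryCode ι} {d i : ℕ} (hi : 0 < i) (hd : 2 * i + 1 < d)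
    (h : ∀ v ∈ V, v ≠ 0 → d ≤ hammingNorm v) : (halfEnum V).coeff i = 0 := by
  rw [halfEnum, finsetSum_coeff]
  refine sum_eq_zero fun v hv => ?_
  rw [coeff_X_pow, if_neg]
  by_cases hv0 : v = 0
  · rw [hv0, hammingNorm_zero]
    omega
  · have := h v (mem_words.1 hv) hv0
    omega

theorem eval_halfEnum_sq {V : BinaryCode ι} (hV : V.IsEven) (y : ℝ) :
    (halfEnum V).eval (y ^ 2) = ∑ v ∈ words V, y ^ hammingNorm v := by
  rw [halfEnum, eval_finsetSum]
  refine sum_congr rfl fun v hv => ?_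
  rw [eval_pow, eval_X, ← pow_mul, Nat.mul_div_cancel' (hV v (mem_words.1 hv)).two_dvd]

theorem mul_div_pow_sq {n w : ℕ} (hw : Even w) (hn : w ≤ 2 * n) {y : ℝ} (hy : 1 + y ≠ 0) :
    (1 + y) ^ (2 * n) * (((1 - y) / (1 + y)) ^ 2) ^ (w / 2) =
      (1 + y) ^ (2 * n - w) * (1 - y) ^ w := by
  rw [← pow_mul, Nat.mul_div_cancel' hw.two_dvd, div_pow]
  obtain ⟨k, hk⟩ := Nat.exists_eq_add_of_le hn
  rw [hk, Nat.add_sub_cancel_left, pow_add]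
  field_simp

theorem hadamard_halfEnum {V : BinaryCode ι} (hV : V.IsEven) {n : ℕ}
    (hn : Fintype.card ι = 2 * n) (hd : V.dual.IsEven) {y : ℝ} (hy : 1 + y ≠ 0) :
    (1 + y) ^ (2 * n) * (halfEnum V).eval (((1 - y) / (1 + y)) ^ 2) =
      (words V).card * (halfEnum V.dual).eval (y ^ 2) := by
  rw [eval_halfEnum_sq hd, ← macWilliams, halfEnum, eval_finsetSum, mul_sum, hn]
  refine sum_congr rfl fun v hv => ?_
  have : hammingNorm v ≤ Fintype.card ι := hammingNorm_le_card_fintype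
  rw [eval_pow, eval_X, mul_div_pow_sq (hV v (mem_words.1 hv)) (by omega) hy]

theorem shadow_halfEnum {V : BinaryCode ι} (hV : V.IsEven) {n : ℕ}
    (hn : Fintype.card ι = 2 * n) {y : ℝ} (hy : 1 + y ≠ 0) :
    (1 + y) ^ (2 * n) * (halfEnum V).eval (-((1 - y) / (1 + y)) ^ 2) =
      ∑ u : ι → ZMod 2, shadowTransform V u * y ^ hammingNorm u := by
  rw [sum_shadowTransform_mul_pow, halfEnum, eval_finsetSum, mul_sum, hn]
  refine sum_congr rfl fun v hv => ?_
  have : hammingNorm v ≤ Fintype.card ι := hammingNorm_le_card_fintype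
  rw [eval_pow, eval_X, neg_pow, mul_left_comm,
    mul_div_pow_sq (hV v (mem_words.1 hv)) (by omega) hy, halfSgn]

theorem sum_mul_pow_of_indicator {T : Finset (ι → ZMod 2)} {c : ℝ} {f : (ι → ZMod 2) → ℝ}
    (hf : ∀ u, f u = if u ∈ T then c else 0) (y : ℝ) :
    ∑ u : ι → ZMod 2, f u * y ^ hammingNorm u = c * (weightEnum T).eval y := by
  rw [eval_weightEnum, mul_sum, ← sum_subset (subset_univ T)]
  · exact sum_congr rfl fun u hu => by rw [hf, if_pos hu]
  · intro u _ hu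
    rw [hf, if_neg hu, zero_mul]

/-- An extremal self-dual code of length `24 m` is doubly even. -/
theorem four_dvd_hammingNorm {m : ℕ} (hm : 0 < m) (hι : Fintype.card ι = 24 * m)
    {V : BinaryCode ι} (hV : V.IsSelfDual) (hd : ∀ v ∈ V, v ≠ 0 → 4 * m + 4 ≤ hammingNorm v)
    (v : ι → ZMod 2) (hv : v ∈ V) : 4 ∣ hammingNorm v := by
  have hV' : V.dual = V := hV
  have hle : V ≤ V.dual := hV'.ge
  have heven : V.IsEven := isEven_of_le_dual hle
  have hn : Fintype.card ι = 2 * (12 * m) := by omega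
  have hcard : (words V).card = 2 ^ (12 * m) := by
    have h := card_words_mul_card_words_dual V
    rw [hV', hn, pow_mul, sq, mul_pow] at h
    exact Nat.mul_self_inj.1 h
  have hsemi : IsSemiInvariant (12 * m) (2 ^ (12 * m)) (halfEnum V) := by
    refine isSemiInvariant_of_eval (natDegree_halfEnum_le V hn) fun y hy => ?_
    rw [hadamard_halfEnum heven hn (by rwa [hV']) (by positivity), hV', hcard]
    push_cast
    rfl
  obtain ⟨a, ha⟩ := hsemi.exists_eq_invariantSum
  rw [show 12 * m / 4 = 3 * m by omega] at ha
  have hne := shadow_coeff_zero_ne_zero m hm a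
    (weightEnum (univ.filter fun u => ∀ v ∈ V, halfSgn v * sgn (v ⬝ᵥ u) = 1))
    (by rw [← ha]; exact coeff_zero_halfEnum fun v hv hv0 => by have := hd v hv hv0; omega)
    (fun i hi hi' => by rw [← ha]; exact coeff_halfEnum_eq_zero hi (by omega) hd)
    (fun k => by rw [coeff_weightEnum]; positivity)
    (fun y hy => by
      rw [← ha, show 24 * m = 2 * (12 * m) by ring, shadow_halfEnum heven hn (by positivity)]
      rw [sum_mul_pow_of_indicator (c := (words V).card) fun u => ?_, hcard]
      · push_cast
        rfl
      · rw [shadowTransform_of_le_dual hle]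
        simp)
  rw [coeff_weightEnum, Nat.cast_ne_zero, card_ne_zero] at hne
  obtain ⟨u, hu⟩ := hne
  rw [mem_filter, mem_filter] at hu
  have hu0 : u = 0 := hammingNorm_eq_zero.1 hu.2.symm
  have h1 := hu.1.2 v hv
  rw [hu0, dotProduct_zero, sgn_zero, mul_one, halfSgn] at h1
  obtain ⟨k, hk⟩ := neg_one_pow_eq_one_iff_even (by norm_num) |>.1 h1
  obtain ⟨l, hl⟩ := heven v hv
  omega

/-- A semi self-dual code of length `12 m` has dual distance at most `2 m` if `m` is odd or a
certain binomial coefficient is odd. -/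
theorem semi_self_dual_bound {m : ℕ} (hm : 0 < m) (hι : Fintype.card ι = 12 * m)
    {V : BinaryCode ι} (hle : V ≤ V.dual) (heven : V.dual.IsEven)
    (hcard : (words V.dual).card = 4 * (words V).card)
    (hd : ∀ v ∈ V.dual, v ≠ 0 → 2 * m + 2 ≤ hammingNorm v) :
    ¬ Odd m ∧ ∀ μ, m = 2 * μ → ¬ Odd ((5 * μ - 1).choose (μ - 1)) := by
  have heV : V.IsEven := fun v hv => heven v (hle hv)
  have hn : Fintype.card ι = 2 * (2 * (3 * m)) := by omega
  have hcardV : (words V).card = 2 ^ (6 * m - 1) := by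
    have h := card_words_mul_card_words_dual V
    rw [hcard, hι] at h
    have h2 : (words V).card * (words V).card = 2 ^ (6 * m - 1) * 2 ^ (6 * m - 1) := by
      have h3 : (2 : ℕ) ^ (12 * m) = 4 * (2 ^ (6 * m - 1) * 2 ^ (6 * m - 1)) := by
        rw [← pow_add, show 12 * m = 2 + (6 * m - 1 + (6 * m - 1)) by omega, pow_add]
        norm_num
      rw [h3] at h
      linarith
    exact Nat.mul_self_inj.1 h2
  have hpow : (2 : ℝ) ^ (2 * (3 * m)) = 2 * (words V).card := by
    rw [hcardV, show 2 * (3 * m) = 1 + (6 * m - 1) by omega, pow_add]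
    push_cast
    ring
  -- The transform sends `W_V` to `|V| W_{V^⊥}` and `W_{V^⊥}` to `4|V| W_V`, so this is the
  -- eigenvector for `-2|V|`.
  set Q : ℝ[X] := C 2 * halfEnum V - halfEnum V.dual with hQ
  have hsemi : IsSemiInvariant (2 * (3 * m)) (-2 ^ (2 * (3 * m))) Q := by
    refine isSemiInvariant_of_eval ?_ fun y hy => ?_
    · exact (natDegree_sub_le _ _).trans (max_le ((natDegree_C_mul_le _ _).trans
        (natDegree_halfEnum_le V hn)) (natDegree_halfEnum_le _ hn))
    · have hy' : 1 + y ≠ 0 := by positivity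
      have h1 := hadamard_halfEnum heV hn heven hy'
      have h2 := hadamard_halfEnum heven hn (by rwa [dual_dual]) hy'
      rw [dual_dual, hcard] at h2
      push_cast at h2
      rw [hpow, hQ]
      simp only [eval_sub, eval_mul, eval_C]
      linear_combination 2 * h1 - h2
  obtain ⟨a, ha⟩ := hsemi.exists_eq_mul_invariantSum
  rw [show 2 * (3 * m) - 2 = 6 * m - 2 by omega] at ha
  have hdV : ∀ v ∈ V, v ≠ 0 → 2 * m + 2 ≤ hammingNorm v := fun v hv => hd v (hle hv)
  -- Where the transform of `V` is `|V|`, that of its dual is `±2|V|`; elsewhere both vanish. The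
  -- difference therefore takes only the values 0 and `4|V|`, and counting words in `T` gives the
  -- natural numbers required.
  set T : Finset (ι → ZMod 2) :=
    univ.filter fun u => 2 * shadowTransform V u - shadowTransform V.dual u ≠ 0
  have hT : ∀ u, 2 * shadowTransform V u - shadowTransform V.dual u =
      if u ∈ T then 4 * ((words V).card : ℝ) else 0 := by
    intro u
    have hu : u ∈ T ↔ 2 * shadowTransform V u - shadowTransform V.dual u ≠ 0 := by simp [T]
    split_ifs with h <;> rw [hu] at h
    · have hsq := shadowTransform_dual_sq hle heven u
      have hS := shadowTransform_of_le_dual hle u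
      rw [hcard] at hsq
      push_cast at hsq
      split_ifs at hS with hu
      · rw [hS] at hsq h ⊢
        have h0 : (shadowTransform V.dual u - 2 * (words V).card) *
            (shadowTransform V.dual u + 2 * (words V).card) = 0 := by linear_combination hsq
        rcases mul_eq_zero.1 h0 with h1 | h1
        · exact absurd (by linarith) h
        · linarith
      · rw [hS, mul_zero, mul_self_eq_zero] at hsq
        rw [hS, hsq] at h
        norm_num at h
    · exact not_not.1 h
  refine semi_self_dual_restriction m hm a (weightEnum T) Q
    (fun k => (T.filter fun v => k = hammingNorm v).card) ha ?_ ?_ (coeff_weightEnum T) ?_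
  · rw [hQ, coeff_sub, coeff_C_mul,
      coeff_zero_halfEnum fun v hv hv0 => le_trans (by omega) (hdV v hv hv0),
      coeff_zero_halfEnum fun v hv hv0 => le_trans (by omega) (hd v hv hv0)]
    norm_num
  · intro i hi hi'
    rw [hQ, coeff_sub, coeff_C_mul, coeff_halfEnum_eq_zero hi (by omega) hdV,
      coeff_halfEnum_eq_zero hi (by omega) hd]
    norm_num
  · intro y hy
    have hy' : 1 + y ≠ 0 := by positivity
    have h1 := shadow_halfEnum heV hn hy'
    have h2 := shadow_halfEnum heven hn hy'
    have h3 : (2 : ℝ) ^ (6 * m + 1) = 4 * (words V).card := by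
      rw [pow_succ, show 6 * m = 2 * (3 * m) by ring, hpow]
      ring
    rw [h3, ← sum_mul_pow_of_indicator hT, show 12 * m = 2 * (2 * (3 * m)) by ring, hQ]
    simp only [eval_sub, eval_mul, eval_C]
    rw [mul_sub, mul_left_comm, h1, h2, mul_sum, ← sum_sub_distrib]
    exact sum_congr rfl fun u _ => by ring

end Enumerators

end BinaryCode

namespace BinaryCode

/-! ### Enlarging a self-orthogonal code to index 4 in its dual. -/

section SemiSelfDual

open Finset
open scoped Classical

variable {ι : Type} [Fintype ι]

theorem mem_sup_span_singleton {ι : Type} {V : BinaryCode ι} {x w : ι → ZMod 2} :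
    w ∈ V ⊔ Submodule.span (ZMod 2) {x} ↔ w ∈ V ∨ w + x ∈ V := by
  rw [Submodule.mem_sup]
  constructor
  · rintro ⟨v, hv, y, hy, rfl⟩
    obtain ⟨a, rfl⟩ := Submodule.mem_span_singleton.1 hy
    rcases zmod_two_cases a with rfl | rfl
    · left
      rwa [zero_smul, add_zero]
    · right
      rwa [one_smul, add_add_cancel_self]
  · rintro (h | h)
    · exact ⟨w, h, 0, Submodule.zero_mem _, add_zero w⟩
    · exact ⟨w + x, h, x, Submodule.mem_span_singleton_self x, add_add_cancel_self w x⟩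

theorem card_words_sup_span_singleton {V : BinaryCode ι} {x : ι → ZMod 2} (hx : x ∉ V) :
    (words (V ⊔ Submodule.span (ZMod 2) {x})).card = 2 * (words V).card := by
  have h : words (V ⊔ Submodule.span (ZMod 2) {x}) = words V ∪ (words V).image (· + x) := by
    ext w
    rw [mem_words, mem_sup_span_singleton, mem_union, mem_words, mem_image]
    refine or_congr Iff.rfl ⟨fun h => ⟨w + x, mem_words.2 h, add_add_cancel_self w x⟩, ?_⟩
    rintro ⟨v, hv, rfl⟩
    rw [add_add_cancel_self]
    exact mem_words.1 hv
  rw [h, card_union_of_disjoint, card_image_of_injective _ (add_left_injective x), two_mul]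
  rw [disjoint_left]
  intro w hw hw'
  obtain ⟨v, hv, rfl⟩ := mem_image.1 hw'
  rw [mem_words] at hv hw
  apply hx
  have := V.add_mem hv hw
  rwa [← add_assoc, add_self_eq_zero', zero_add] at this

/-- A self-orthogonal code with even dual which is not self-dual is contained in a self-orthogonal
code of index four in its dual. -/
theorem exists_semi_self_dual {E : BinaryCode ι} (hE : E ≤ E.dual) (heven : E.dual.IsEven)
    (hne : E.dual ≠ E) :
    ∃ V : BinaryCode ι, E ≤ V ∧ V ≤ V.dual ∧ (words V.dual).card = 4 * (words V).card := by
  have hfin : {V : BinaryCode ι | E ≤ V ∧ V ≤ V.dual ∧ V.dual ≠ V}.Finite := Set.toFinite _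
  -- Take `V` maximal among the codes that are not yet self-dual. Adjoining one more even word of
  -- its dual stays self-orthogonal, so it must yield a self-dual code, of twice the size of `V`.
  obtain ⟨V, ⟨hEV, hV, hVne⟩, hmax⟩ := hfin.exists_maximal ⟨E, le_rfl, hE, hne⟩
  refine ⟨V, hEV, hV, ?_⟩
  obtain ⟨x, hxd, hxV⟩ := SetLike.exists_of_lt (lt_of_le_of_ne hV hVne.symm)
  set W := V ⊔ Submodule.span (ZMod 2) {x} with hW
  have hVW : V ≤ W := le_sup_left
  have hxW : x ∈ W := le_sup_right (a := V) (Submodule.mem_span_singleton_self x)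
  have hxx : x ⬝ᵥ x = 0 := (even_hammingNorm_iff x).1 (heven x (dual_anti hEV hxd))
  have hWx : ∀ w ∈ W, w ⬝ᵥ x = 0 := by
    intro w hw
    rcases mem_sup_span_singleton.1 hw with h | h
    · exact hxd w h
    · have := hxd _ h
      rwa [add_dotProduct, hxx, add_zero] at this
  have hWW : W ≤ W.dual := by
    intro w hw c hc
    have hVd : ∀ v ∈ V, ∀ c ∈ W, c ⬝ᵥ v = 0 := by
      intro v hv c hc
      rcases mem_sup_span_singleton.1 hc with h | h
      · exact hV hv c h
      · have h1 := hV hv _ h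
        rwa [add_dotProduct, dotProduct_comm x v, hxd v hv, add_zero] at h1
    rcases mem_sup_span_singleton.1 hw with h | h
    · exact hVd w h c hc
    · have h1 := hVd _ h c hc
      rwa [dotProduct_add, hWx c hc, add_zero] at h1
  have hWself : W.dual = W := by
    by_contra hWne
    exact hxV (hmax ⟨hEV.trans hVW, hWW, hWne⟩ hVW hxW)
  have h1 := card_words_mul_card_words_dual V
  have h2 := card_words_mul_card_words_dual W
  rw [hWself, card_words_sup_span_singleton hxV, ← h1] at h2
  apply Nat.eq_of_mul_eq_mul_left (card_words_pos V)
  rw [← h2]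
  ring

end SemiSelfDual

/-! ### Orbit sums and the projected fixed code. -/

section Involution

open Finset
open scoped Classical

variable {ι : Type} {s : Equiv.Perm ι}

/-- The orbit of a coordinate. -/
abbrev orbitMk (s : Equiv.Perm ι) (i : ι) : Orbits s :=
  Quotient.mk (Equiv.Perm.SameCycle.setoid s) i

theorem orbitMk_eq_iff (hs : ∀ i, s (s i) = i) {i j : ι} :
    orbitMk s i = orbitMk s j ↔ j = i ∨ j = s i := by
  rw [Quotient.eq]
  constructor
  · rintro ⟨k, rfl⟩
    rcases Int.even_or_odd' k with ⟨l, rfl | rfl⟩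
    · left
      have h2 : s ^ (2 : ℤ) = 1 := by
        ext i
        simp [zpow_ofNat, pow_two, hs]
      rw [zpow_mul, h2, one_zpow, Equiv.Perm.one_apply]
    · right
      have h2 : s ^ (2 : ℤ) = 1 := by
        ext i
        simp [zpow_ofNat, pow_two, hs]
      rw [zpow_add, zpow_mul, h2, one_zpow, one_mul, zpow_one]
  · rintro (rfl | rfl)
    · exact Equiv.Perm.SameCycle.refl s _
    · exact ⟨1, by simp⟩

theorem out_orbitMk (hs : ∀ i, s (s i) = i) (i : ι) :
    (orbitMk s i).out = i ∨ (orbitMk s i).out = s i :=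
  (orbitMk_eq_iff hs).1 (Quotient.out_eq _).symm

theorem orbitMk_apply (hs : ∀ i, s (s i) = i) (i : ι) : orbitMk s (s i) = orbitMk s i :=
  (orbitMk_eq_iff hs).2 (Or.inr (hs i).symm)

theorem sum_eq_sum_orbits [Fintype ι] {M : Type} [AddCommMonoid M] (hs : ∀ i, s (s i) = i)
    (hfix : ∀ i, s i ≠ i) (f : ι → M) :
    ∑ i, f i = ∑ o : Orbits s, (f o.out + f (s o.out)) := by
  rw [← sum_fiberwise univ (fun i => orbitMk s i) f]
  refine sum_congr rfl fun o _ => ?_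
  have h : univ.filter (fun i => orbitMk s i = o) = {o.out, s o.out} := by
    ext i
    rw [mem_filter, mem_insert, mem_singleton]
    have h1 : o = orbitMk s o.out := (Quotient.out_eq o).symm
    conv_lhs => rw [h1, eq_comm, orbitMk_eq_iff hs]
    simp
  rw [h, sum_pair (hfix _).symm]

theorem card_eq_two_mul_card_orbits [Fintype ι] (hs : ∀ i, s (s i) = i) (hfix : ∀ i, s i ≠ i) :
    Fintype.card ι = 2 * Fintype.card (Orbits s) := by
  have h := sum_eq_sum_orbits hs hfix fun _ => (1 : ℕ)
  simp only [sum_const, card_univ, smul_eq_mul, mul_one] at h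
  omega

/-- Repeating a word along the orbits. -/
def orbitLift (s : Equiv.Perm ι) : (Orbits s → ZMod 2) →ₗ[ZMod 2] ι → ZMod 2 :=
  LinearMap.funLeft (ZMod 2) (ZMod 2) (orbitMk s)

/-- The word of sums over the two-element orbits of an involution. -/
noncomputable def orbitSum (s : Equiv.Perm ι) : (ι → ZMod 2) →ₗ[ZMod 2] Orbits s → ZMod 2 where
  toFun c o := c o.out + c (s o.out)
  map_add' c d := by
    funext o
    simp only [Pi.add_apply]
    ring
  map_smul' a c := by
    funext o
    simp only [Pi.smul_apply, smul_eq_mul, RingHom.id_apply]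
    ring

theorem orbitLift_apply (d : Orbits s → ZMod 2) (i : ι) : orbitLift s d i = d (orbitMk s i) := rfl

theorem orbitSum_apply (c : ι → ZMod 2) (o : Orbits s) :
    orbitSum s c o = c o.out + c (s o.out) := rfl

theorem permRep_apply (hs : ∀ i, s (s i) = i) (c : ι → ZMod 2) (i : ι) :
    permRep ι s c i = c (s i) := by
  change c (s⁻¹ i) = c (s i)
  rw [Equiv.Perm.inv_eq_iff_eq.2 (hs i).symm]

theorem orbitLift_orbitSum (hs : ∀ i, s (s i) = i) (c : ι → ZMod 2) :
    orbitLift s (orbitSum s c) = c + permRep ι s c := by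
  funext i
  rw [orbitLift_apply, orbitSum_apply, Pi.add_apply, permRep_apply hs]
  rcases out_orbitMk hs i with h | h
  · rw [h]
  · rw [h, hs, add_comm]

theorem orbitLift_injective : Function.Injective (orbitLift s) :=
  LinearMap.funLeft_injective_of_surjective _ _ _ Quotient.mk_surjective

theorem permRep_orbitLift (hs : ∀ i, s (s i) = i) (d : Orbits s → ZMod 2) :
    permRep ι s (orbitLift s d) = orbitLift s d := by
  funext i
  rw [permRep_apply hs, orbitLift_apply, orbitLift_apply, orbitMk_apply hs]

theorem exists_orbitLift_eq (hs : ∀ i, s (s i) = i) {c : ι → ZMod 2} (hc : permRep ι s c = c) :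
    ∃ d, orbitLift s d = c := by
  refine ⟨fun o => c o.out, funext fun i => ?_⟩
  rcases out_orbitMk hs i with h | h
  · exact congrArg c h
  · exact (congrArg c h).trans ((permRep_apply hs c i).symm.trans (congrFun hc i))

theorem mem_projFixedCode (hs : ∀ i, s (s i) = i) {C : BinaryCode ι} {d : Orbits s → ZMod 2} :
    d ∈ C.projFixedCode s ↔ orbitLift s d ∈ C :=
  ⟨fun h => h.1, fun h => ⟨h, permRep_orbitLift hs d⟩⟩

theorem map_orbitSum_le (hs : ∀ i, s (s i) = i) {C : BinaryCode ι}
    (hinv : ∀ c ∈ C, permRep ι s c ∈ C) : C.map (orbitSum s) ≤ C.projFixedCode s := by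
  rintro _ ⟨c, hc, rfl⟩
  rw [mem_projFixedCode hs, orbitLift_orbitSum hs]
  exact C.add_mem hc (hinv c hc)

variable [Fintype ι]

theorem dotProduct_orbitLift (hs : ∀ i, s (s i) = i) (hfix : ∀ i, s i ≠ i) (c : ι → ZMod 2)
    (d : Orbits s → ZMod 2) : c ⬝ᵥ orbitLift s d = orbitSum s c ⬝ᵥ d := by
  rw [dotProduct, sum_eq_sum_orbits hs hfix, dotProduct]
  refine sum_congr rfl fun o _ => ?_
  rw [orbitLift_apply, orbitLift_apply, orbitMk_apply hs, orbitSum_apply, add_mul]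
  have h : orbitMk s o.out = o := Quotient.out_eq o
  rw [h]

theorem hammingNorm_orbitLift (hs : ∀ i, s (s i) = i) (hfix : ∀ i, s i ≠ i)
    (d : Orbits s → ZMod 2) : hammingNorm (orbitLift s d) = 2 * hammingNorm d := by
  rw [hammingNorm, hammingNorm, card_filter, card_filter, sum_eq_sum_orbits hs hfix, mul_sum]
  refine sum_congr rfl fun o _ => ?_
  have h : orbitMk s o.out = o := Quotient.out_eq o
  rw [orbitLift_apply, orbitLift_apply, orbitMk_apply hs, h, two_mul]

theorem dual_map_orbitSum (hs : ∀ i, s (s i) = i) (hfix : ∀ i, s i ≠ i) {C : BinaryCode ι}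
    (hC : C.IsSelfDual) : BinaryCode.dual (C.map (orbitSum s)) = C.projFixedCode s := by
  ext d
  rw [mem_projFixedCode hs]
  have hC' : C.dual = C := hC
  conv_rhs => rw [← hC']
  constructor
  · intro h c hc
    rw [dotProduct_orbitLift hs hfix]
    exact h _ (Submodule.mem_map_of_mem hc)
  · rintro h _ ⟨c, hc, rfl⟩
    rw [← dotProduct_orbitLift hs hfix]
    exact h c hc

theorem dual_projFixedCode (hs : ∀ i, s (s i) = i) (hfix : ∀ i, s i ≠ i) {C : BinaryCode ι}
    (hC : C.IsSelfDual) : (C.projFixedCode s).dual = C.map (orbitSum s) := by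
  rw [← dual_map_orbitSum hs hfix hC, dual_dual]

/-- Lifting orbit sums back to the coordinates gives the words `b + σ(b)`, so self-duality says that
every fixed codeword arises in this way from `C`. -/
theorem projFixedCode_isSelfDual_iff (hs : ∀ i, s (s i) = i) (hfix : ∀ i, s i ≠ i)
    {C : BinaryCode ι} (hC : C.IsSelfDual) (hinv : ∀ c ∈ C, permRep ι s c ∈ C) :
    (C.projFixedCode s).IsSelfDual ↔
      ∀ c ∈ C, permRep ι s c = c → ∃ b ∈ C, b + permRep ι s b = c := by
  rw [IsSelfDual, dual_projFixedCode hs hfix hC]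
  constructor
  · intro h c hc hcs
    obtain ⟨d, rfl⟩ := exists_orbitLift_eq hs hcs
    have hd : d ∈ C.projFixedCode s := (mem_projFixedCode hs).2 hc
    rw [← h] at hd
    obtain ⟨b, hb, rfl⟩ := hd
    exact ⟨b, hb, (orbitLift_orbitSum hs b).symm⟩
  · intro h
    refine le_antisymm (map_orbitSum_le hs hinv) fun d hd => ?_
    obtain ⟨b, hb, hbd⟩ := h _ ((mem_projFixedCode hs).1 hd) (permRep_orbitLift hs d)
    rw [← orbitLift_orbitSum hs] at hbd
    exact ⟨b, hb, orbitLift_injective hbd⟩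

/-- The projected fixed code of a fixed point free involution of an extremal code of length
`24 m` is self-dual under the given conditions on `m`. -/
theorem projFixedCode_isSelfDual {m : ℕ} (hm : 0 < m) (hι : Fintype.card ι = 24 * m)
    (hs : ∀ i, s (s i) = i) (hfix : ∀ i, s i ≠ i) {C : BinaryCode ι} (hC : C.IsSelfDual)
    (hinv : ∀ c ∈ C, permRep ι s c ∈ C) (hd : ∀ v ∈ C, v ≠ 0 → 4 * m + 4 ≤ hammingNorm v)
    (hcond : Odd m ∨ ∃ μ : ℕ, m = 2 * μ ∧ Odd (Nat.choose (5 * μ - 1) (μ - 1))) :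
    (C.projFixedCode s).IsSelfDual := by
  by_contra hne
  set E : BinaryCode (Orbits s) := C.map (orbitSum s) with hE
  have hdual : E.dual = C.projFixedCode s := dual_map_orbitSum hs hfix hC
  have hcard : Fintype.card (Orbits s) = 12 * m := by
    have := card_eq_two_mul_card_orbits hs hfix
    omega
  -- Lifting doubles weights, so double evenness of `C` descends to evenness.
  have heven : E.dual.IsEven := by
    intro d hdE
    rw [hdual, mem_projFixedCode hs] at hdE
    have := four_dvd_hammingNorm hm hι hC hd _ hdE
    rw [hammingNorm_orbitLift hs hfix] at this
    rw [even_iff_two_dvd]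
    omega
  have hEne : E.dual ≠ E := by
    intro h
    apply hne
    rw [IsSelfDual, ← hdual, dual_dual, h]
  obtain ⟨V, hEV, hV, hVcard⟩ := exists_semi_self_dual
    (hdual ▸ map_orbitSum_le hs hinv) heven hEne
  have hVd : V.dual ≤ E.dual := dual_anti hEV
  have h := semi_self_dual_bound hm hcard hV (fun v hv => heven v (hVd hv)) hVcard
    fun v hv hv0 => by
      have h1 := hVd hv
      rw [hdual, mem_projFixedCode hs] at h1
      have h2 := hd _ h1 fun h0 => hv0 (orbitLift_injective (by rw [h0, map_zero]))
      rw [hammingNorm_orbitLift hs hfix] at h2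
      omega
  rcases hcond with h1 | ⟨μ, hμ, h1⟩
  · exact h.1 h1
  · exact h.2 μ hμ h1

end Involution

end BinaryCode

/-! ### Freeness over dual numbers. -/

section DualNumbers

variable {k R M : Type} [Field k] [Ring R] [Algebra k R] [AddCommGroup M] [Module k M] [Module R M]
  [IsScalarTower k R M]

/-- A module over an algebra with basis `1, e` and `e * e = 0` is free if and only if every element
annihilated by `e` is a multiple of `e`. -/
theorem free_iff_exists_smul_eq {e : R} (hee : e * e = 0)
    (hspan : ∀ r : R, ∃ a c : k, r = algebraMap k R a + algebraMap k R c * e)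
    (hind : ∀ a c : k, algebraMap k R a + algebraMap k R c * e = 0 → a = 0 ∧ c = 0) :
    Module.Free R M ↔ ∀ x : M, e • x = 0 → ∃ y : M, e • y = x := by
  constructor
  · intro hfree x hx
    -- The annihilator of `e` in `R` is `eR`; this passes to a free module coordinatewise.
    have hr : ∀ r : R, e * r = 0 → ∃ r', e * r' = r := by
      intro r hr
      obtain ⟨a, c, rfl⟩ := hspan r
      have h1 : algebraMap k R 0 + algebraMap k R a * e = 0 := by
        rw [mul_add, ← Algebra.commutes, ← mul_assoc, ← Algebra.commutes, mul_assoc, hee,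
          mul_zero, add_zero] at hr
        rw [map_zero, zero_add, hr]
      obtain ⟨-, rfl⟩ := hind _ _ h1
      exact ⟨algebraMap k R c, by rw [map_zero, zero_add, Algebra.commutes]⟩
    let B := Module.Free.chooseBasis R M
    have hB : ∀ i, e * B.repr x i = 0 := by
      intro i
      have := congrArg (fun z => B.repr z i) hx
      simpa using this
    choose f hf using fun i => hr _ (hB i)
    refine ⟨∑ i ∈ (B.repr x).support, f i • B i, ?_⟩
    rw [Finset.smul_sum]
    conv_rhs => rw [← B.linearCombination_repr x, Finsupp.linearCombination_apply, Finsupp.sum]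
    exact Finset.sum_congr rfl fun i _ => by rw [smul_smul, hf]
  · intro h
    have hcomm : ∀ (a : k) (x : M), e • a • x = a • e • x := by
      intro a x
      rw [← algebraMap_smul R a x, ← algebraMap_smul R a (e • x), smul_smul, smul_smul,
        Algebra.commutes]
    let L : M →ₗ[k] M :=
      { toFun := fun x => e • x
        map_add' := fun x y => smul_add e x y
        map_smul' := hcomm }
    -- Preimages `v i` of a `k`-basis of `eM` will form an `R`-basis of `M`.
    let b := Module.Basis.ofVectorSpace k (LinearMap.range L)
    choose v hv using fun i => (b i).2
    have hv' : ∀ i, e • v i = (b i : M) := hv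
    have hR : ∀ (a c : k) (x : M), (algebraMap k R a + algebraMap k R c * e) • x =
        a • x + c • e • x := by
      intro a c x
      rw [add_smul, mul_smul, algebraMap_smul, algebraMap_smul]
    have hbi := b.linearIndependent.map' (LinearMap.range L).subtype (Submodule.ker_subtype _)
    rw [linearIndependent_iff'] at hbi
    have hli : LinearIndependent R v := by
      rw [linearIndependent_iff']
      intro t g hg i hi
      choose a c hac using fun i => hspan (g i)
      -- Multiplying the relation by `e` isolates the scalar parts; the `e`-parts are then read from
      -- the relation itself.
      have ha : ∀ i ∈ t, a i = 0 := by
        refine hbi t a ?_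
        have h1 := congrArg (fun z => e • z) hg
        simp only [smul_zero, Finset.smul_sum] at h1
        rw [← h1]
        refine Finset.sum_congr rfl fun j _ => ?_
        rw [hac j, hR, smul_add, hcomm, hcomm, smul_smul e e, hee, zero_smul, smul_zero, add_zero,
          hv']
        rfl
      have hc : ∀ i ∈ t, c i = 0 := by
        refine hbi t c ?_
        rw [← hg]
        refine Finset.sum_congr rfl fun j hj => ?_
        rw [hac j, hR, ha j hj, zero_smul, zero_add, hv']
        rfl
      rw [hac i, ha i hi, hc i hi]
      simp
    have hsmul : ∀ (a : k) (x : M), x ∈ Submodule.span R (Set.range v) →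
        a • x ∈ Submodule.span R (Set.range v) := by
      intro a x hx
      rw [← algebraMap_smul R a x]
      exact Submodule.smul_mem _ _ hx
    have hvs : ∀ i, v i ∈ Submodule.span R (Set.range v) := fun i =>
      Submodule.subset_span ⟨i, rfl⟩
    have hrange : ∀ x : M, e • x ∈ Submodule.span R (Set.range v) ∧
        ∃ z ∈ Submodule.span R (Set.range v), e • z = e • x := by
      intro x
      have hx : ((⟨e • x, x, rfl⟩ : LinearMap.range L) : M) = e • x := rfl
      rw [← hx, ← b.linearCombination_repr ⟨e • x, x, rfl⟩, Finsupp.linearCombination_apply,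
        Finsupp.sum, AddSubmonoidClass.coe_finsetSum]
      refine ⟨Submodule.sum_mem _ fun i _ => ?_,
        ∑ i ∈ (b.repr ⟨e • x, x, rfl⟩).support, b.repr ⟨e • x, x, rfl⟩ i • v i,
        Submodule.sum_mem _ fun i _ => hsmul _ _ (hvs i), ?_⟩
      · rw [Submodule.coe_smul, ← hv' i]
        exact hsmul _ _ (Submodule.smul_mem _ _ (hvs i))
      · rw [Finset.smul_sum]
        refine Finset.sum_congr rfl fun i _ => ?_
        rw [hcomm, hv', Submodule.coe_smul]
    refine Module.Free.of_basis (Module.Basis.mk hli fun x _ => ?_)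
    obtain ⟨z, hz, hzx⟩ := (hrange x).2
    -- `z` in the span has the same image as `x`, so `x - z` is killed by `e` and hence lies in
    -- `eM`, which is already spanned.
    obtain ⟨y, hy⟩ := h (x - z) (by rw [smul_sub, hzx, sub_self])
    have h1 := Submodule.add_mem _ (hrange y).1 hz
    rwa [hy, sub_add_cancel] at h1

end DualNumbers

/-! ### The group algebra of an involution, and the conclusion. -/

namespace BinaryCode

/-- The group algebra over `𝔽₂` of a group of order two is an algebra of dual numbers. -/
theorem dualNumbers_of_order_two {G : Type} [Group G] {g : G} (hg2 : g * g = 1) (hg1 : g ≠ 1)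
    (hG : ∀ x : G, x = 1 ∨ x = g) :
    (1 + MonoidAlgebra.of (ZMod 2) G g) * (1 + MonoidAlgebra.of (ZMod 2) G g) = 0 ∧
    (∀ r : MonoidAlgebra (ZMod 2) G, ∃ a c : ZMod 2, r = algebraMap (ZMod 2) _ a +
      algebraMap (ZMod 2) _ c * (1 + MonoidAlgebra.of (ZMod 2) G g)) ∧
    ∀ a c : ZMod 2, algebraMap (ZMod 2) (MonoidAlgebra (ZMod 2) G) a +
      algebraMap (ZMod 2) _ c * (1 + MonoidAlgebra.of (ZMod 2) G g) = 0 → a = 0 ∧ c = 0 := by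
  have halg : ∀ a : ZMod 2, algebraMap (ZMod 2) (MonoidAlgebra (ZMod 2) G) a =
      MonoidAlgebra.single 1 a := fun a => by simp
  have hsingle : ∀ a : ZMod 2, algebraMap (ZMod 2) (MonoidAlgebra (ZMod 2) G) a *
      MonoidAlgebra.of (ZMod 2) G g = MonoidAlgebra.single g a := fun a => by
    rw [halg, MonoidAlgebra.of_apply, MonoidAlgebra.single_mul_single, one_mul, mul_one]
  refine ⟨?_, fun r => ?_, fun a c h => ?_⟩
  · have htwo : (1 + 1 : MonoidAlgebra (ZMod 2) G) = 0 := by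
      have h : (1 + 1 : ZMod 2) = 0 := by decide
      have := congrArg (algebraMap (ZMod 2) (MonoidAlgebra (ZMod 2) G)) h
      rwa [map_add, map_one, map_zero] at this
    have h2 : (1 + MonoidAlgebra.of (ZMod 2) G g) * (1 + MonoidAlgebra.of (ZMod 2) G g) =
        (1 + 1) * (1 + MonoidAlgebra.of (ZMod 2) G g) := by
      rw [mul_add, mul_one, add_mul, add_mul, ← map_mul, hg2, map_one, one_mul, one_mul]
      abel
    rw [h2, htwo, zero_mul]
  · induction r using MonoidAlgebra.induction_linear with
    | zero => exact ⟨0, 0, by simp⟩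
    | add r r' hr hr' =>
      obtain ⟨a, c, rfl⟩ := hr
      obtain ⟨a', c', rfl⟩ := hr'
      refine ⟨a + a', c + c', ?_⟩
      rw [map_add, map_add, add_mul]
      abel
    | single x t =>
      rcases hG x with rfl | rfl
      · exact ⟨t, 0, by rw [map_zero, zero_mul, add_zero, halg]⟩
      -- In characteristic 2, `g = 1 + (1 + g)`.
      · refine ⟨t, t, ?_⟩
        rw [mul_add, mul_one, hsingle, ← add_assoc, ← map_add, CharTwo.add_self_eq_zero, map_zero,
          zero_add]
  · rw [mul_add, mul_one, hsingle, halg, halg] at h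
    have h1 := congrArg (fun r : MonoidAlgebra (ZMod 2) G => r.coeff 1) h
    have h2 := congrArg (fun r : MonoidAlgebra (ZMod 2) G => r.coeff g) h
    simp [hg1, hg1.symm] at h1 h2
    subst h2
    simpa using h1

theorem isFreeModule_iff {ι : Type} [Fintype ι] (C : BinaryCode ι) (σ : C.autGroup)
    (hσ : orderOf σ = 2) :
    C.IsFreeModule σ ↔ ∀ c ∈ C, permRep ι (σ : Equiv.Perm ι) c = c →
      ∃ b ∈ C, b + permRep ι (σ : Equiv.Perm ι) b = c := by
  let G := Subgroup.zpowers σ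
  let g : G := ⟨σ, Subgroup.mem_zpowers σ⟩
  have hg2 : g * g = 1 := by
    apply Subtype.ext
    change σ * σ = 1
    rw [← pow_two, ← hσ, pow_orderOf_eq_one]
  have hg1 : g ≠ 1 := by
    intro h
    have : σ = 1 := congrArg Subtype.val h
    rw [this, orderOf_one] at hσ
    omega
  have hG : ∀ x : G, x = 1 ∨ x = g := by
    rintro ⟨x, k, rfl⟩
    have hk2 : σ ^ (2 : ℤ) = 1 := by
      rw [zpow_ofNat, ← hσ, pow_orderOf_eq_one]
    rcases Int.even_or_odd' k with ⟨l, rfl | rfl⟩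
    · left
      apply Subtype.ext
      change σ ^ (2 * l) = 1
      rw [zpow_mul, hk2, one_zpow]
    · right
      apply Subtype.ext
      change σ ^ (2 * l + 1) = σ
      rw [zpow_add, zpow_mul, hk2, one_zpow, one_mul, zpow_one]
  obtain ⟨hee, hspan, hind⟩ := dualNumbers_of_order_two hg2 hg1 hG
  set γ := MonoidAlgebra.of (ZMod 2) G g
  have hsmul : ∀ x : (C.cyclicRep σ).asModule,
      (C.cyclicRep σ).asModuleEquiv ((1 + γ) • x) = (C.cyclicRep σ).asModuleEquiv x +
        C.cyclicRep σ g ((C.cyclicRep σ).asModuleEquiv x) := by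
    intro x
    rw [add_smul, one_smul, map_add, Representation.asModuleEquiv_map_smul]
    congr 1
    rw [Representation.asAlgebraHom_of]
  rw [IsFreeModule, free_iff_exists_smul_eq (k := ZMod 2) hee hspan hind]
  have hval : ∀ c : C, ((C.cyclicRep σ g c : C) : ι → ZMod 2) = permRep ι (σ : Equiv.Perm ι) c :=
    fun _ => rfl
  constructor
  · intro h c hc hfix
    obtain ⟨y, hy⟩ := h ((C.cyclicRep σ).asModuleEquiv.symm ⟨c, hc⟩) (by
      apply (C.cyclicRep σ).asModuleEquiv.injective
      rw [hsmul, map_zero, LinearEquiv.apply_symm_apply]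
      apply Subtype.ext
      rw [Submodule.coe_add, hval, hfix, add_self_eq_zero']
      rfl)
    refine ⟨(C.cyclicRep σ).asModuleEquiv y, ((C.cyclicRep σ).asModuleEquiv y).2, ?_⟩
    have h1 := congrArg (fun z => (((C.cyclicRep σ).asModuleEquiv z : C) : ι → ZMod 2)) hy
    simp only [hsmul, LinearEquiv.apply_symm_apply, Submodule.coe_add, hval] at h1
    exact h1
  · intro h x hx
    have h0 := congrArg (fun z => (((C.cyclicRep σ).asModuleEquiv z : C) : ι → ZMod 2)) hx
    simp only [hsmul, map_zero, Submodule.coe_add, hval, ZeroMemClass.coe_zero] at h0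
    have hfix : permRep ι (σ : Equiv.Perm ι) ((C.cyclicRep σ).asModuleEquiv x : C) =
        ((C.cyclicRep σ).asModuleEquiv x : C) := by
      have h1 := congrArg (fun z => ((((C.cyclicRep σ).asModuleEquiv x : C) : ι → ZMod 2)) + z) h0
      simpa only [← add_assoc, add_self_eq_zero', zero_add, add_zero] using h1
    obtain ⟨b, hb, hbx⟩ := h _ ((C.cyclicRep σ).asModuleEquiv x).2 hfix
    refine ⟨(C.cyclicRep σ).asModuleEquiv.symm ⟨b, hb⟩, ?_⟩
    apply (C.cyclicRep σ).asModuleEquiv.injective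
    rw [hsmul, LinearEquiv.apply_symm_apply]
    exact Subtype.ext hbx

theorem IsExtremal.le_hammingNorm {m : ℕ} {C : BinaryCode (Fin (24 * m))} (hC : C.IsExtremal)
    (v : Fin (24 * m) → ZMod 2) (hv : v ∈ C) (hv0 : v ≠ 0) : 4 * m + 4 ≤ hammingNorm v := by
  have h := hC.2
  rw [if_neg (by omega), Nat.mul_div_cancel_left m (by norm_num)] at h
  rw [← h]
  exact Nat.sInf_le ⟨v, hv, hv0, rfl⟩

end BinaryCode

theorem theorem1 (m : ℕ) (hm : 0 < m) (C : BinaryCode (Fin (24 * m))) (hC : C.IsExtremal)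
    (σ : C.autGroup) (hσ : orderOf σ = 2)
    (hfix : ∀ i : Fin (24 * m), (σ : Equiv.Perm (Fin (24 * m))) i ≠ i) :
    ((Odd m ∨ ∃ μ : ℕ, m = 2 * μ ∧ Odd (Nat.choose (5 * μ - 1) (μ - 1))) → C.IsFreeModule σ) ∧
      (C.IsFreeModule σ ↔
        (C.projFixedCode (σ : Equiv.Perm (Fin (24 * m)))).IsSelfDual) := by
  have hs : ∀ i, (σ : Equiv.Perm (Fin (24 * m))) ((σ : Equiv.Perm (Fin (24 * m))) i) = i := by
    intro i
    have h : σ ^ 2 = 1 := by rw [← hσ, pow_orderOf_eq_one]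
    have h1 := congrArg (fun τ : C.autGroup => (τ : Equiv.Perm (Fin (24 * m))) i) h
    simpa [pow_two] using h1
  have hinv : ∀ c ∈ C, BinaryCode.permRep _ (σ : Equiv.Perm (Fin (24 * m))) c ∈ C :=
    C.permRep_mem σ
  have hiff : C.IsFreeModule σ ↔
      (C.projFixedCode (σ : Equiv.Perm (Fin (24 * m)))).IsSelfDual :=
    (C.isFreeModule_iff σ hσ).trans
      (BinaryCode.projFixedCode_isSelfDual_iff hs hfix hC.1 hinv).symm
  exact ⟨fun hcond => hiff.2 (BinaryCode.projFixedCode_isSelfDual hm (Fintype.card_fin _) hs hfix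
    hC.1 hinv hC.le_hammingNorm hcond), hiff⟩
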